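/- Let $G$ be a finite simple graph on $n \ge 10$ vertices. A vertex of degree $1$ is called pendant, and a vertex adjacent to a pendant vertex is called quasi-pendant. Suppose that - $G$ is unicyclic, i.e. connected with exactly one cycle; - $G$ is reduced, i.e. the number of pendant vertices of $G$ equals the number of quasi-pendant vertices of $G$; - $G$ has no pendant path $P_3$, i.e. $G$ does not arise from a graph $G_1$ and a disjoint path $P_3$ on three vertices by joining an end vertex of $P_3$ by an edge to a vertex of $G_1$. Let $m_{L(G)}(1)$ be the multiplicity of $1$ as an eigenvalue of the Laplacian matrix $L(G)=D(G)-A(G)$ (equal to $0$ if $1$ is not an eigenvalue). Then $$m_{L(G)}(1)\le \frac n4,$$ and equality holds if and only if $G$ is isomorphic, for some $t$, to the graph on $4t$ vertices obtained from the cycle $C_{3t}$ with vertices $0,1,\dots,3t-1$ in cyclic order by attaching one new pendant vertex to each of the cycle vertices $0,3,6,\dots,3(t-1)$. (Since $n \ge 10$, such a $t$ satisfies $t=n/4\ge 3$.) -/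

import Mathlib

namespace ReducedUnicyclic

/-- The set of pendant vertices of `G`: the vertices of degree `1`. -/
def pendantVertices {V : Type*} [Fintype V] [DecidableEq V] (G : SimpleGraph V)
    [DecidableRel G.Adj] : Finset V :=
  Finset.univ.filter fun u => G.degree u = 1

/-- The set of quasi-pendant vertices of `G`: the vertices adjacent to a pendant vertex. -/
def quasiPendantVertices {V : Type*} [Fintype V] [DecidableEq V] (G : SimpleGraph V)
    [DecidableRel G.Adj] : Finset V :=
  Finset.univ.filter fun v => ∃ u ∈ pendantVertices G, G.Adj u v

/-- A graph is reduced if it has as many pendant vertices as quasi-pendant vertices. -/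
def IsReducedGraph {V : Type*} [Fintype V] [DecidableEq V] (G : SimpleGraph V)
    [DecidableRel G.Adj] : Prop :=
  (pendantVertices G).card = (quasiPendantVertices G).card

/-- `G` has a pendant path `P_k`: there is an induced path `f 0, …, f (k - 1)` in `G` such that
exactly one edge of `G` joins this path to the rest of the graph, and that edge joins the end
`f 0` of the path to a vertex `w` outside it. In other words, `G` arises from a graph `G₁`
and a disjoint path `P_k` by joining an end of the path to a vertex `w` of `G₁`. -/
def HasPendantPath {V : Type*} (G : SimpleGraph V) (k : ℕ) : Prop :=
  ∃ (f : SimpleGraph.pathGraph k ↪g G) (w : V), w ∉ Set.range f ∧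
    ∀ (i : Fin k) (v : V), v ∉ Set.range f → (G.Adj (f i) v ↔ i.val = 0 ∧ v = w)

/-- A graph is unicyclic if it is connected and contains exactly one cycle
(a cycle being identified with its set of edges). -/
def IsUnicyclic {V : Type*} (G : SimpleGraph V) : Prop :=
  G.Connected ∧
    ∃! C : Set (Sym2 V), ∃ (v : V) (p : G.Walk v v), p.IsCycle ∧ p.edgeSet = C

/-- The multiplicity `m_{L(G)}(c)` of the real number `c` as an eigenvalue of the Laplacian matrix
`L(G) = D(G) - A(G)`: the dimension of its eigenspace (which is `0` if `c` is not an
eigenvalue). As `L(G)` is real symmetric, geometric and algebraic multiplicities agree. -/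
noncomputable def lapMultiplicity {V : Type*} [Fintype V] [DecidableEq V] (G : SimpleGraph V)
    [DecidableRel G.Adj] (c : ℝ) : ℕ :=
  Module.finrank ℝ (Module.End.eigenspace (Matrix.toLin' (G.lapMatrix ℝ)) c)

/-- The cycle with vertices `0, 1, …, 3t - 1` (as `Sum.inl`), with a new pendant vertex
(`Sum.inr s`) attached to the cycle vertex `3s` for every `s < t`; it has `4t` vertices. -/
def extremalGraph (t : ℕ) : SimpleGraph (Fin (3 * t) ⊕ Fin t) where
  Adj
    | Sum.inl i, Sum.inl j => (SimpleGraph.cycleGraph (3 * t)).Adj i j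
    | Sum.inl i, Sum.inr s => i.val = 3 * s.val
    | Sum.inr s, Sum.inl i => i.val = 3 * s.val
    | Sum.inr _, Sum.inr _ => False
  symm := ⟨by
    rintro (i | s) (j | r) h
    · exact SimpleGraph.Adj.symm h
    · exact h
    · exact h
    · exact h⟩
  loopless := ⟨by
    rintro (i | s) h
    · exact SimpleGraph.irrefl _ h
    · exact h⟩

end ReducedUnicyclic

set_option linter.unusedSectionVars false

/-! Let P, Q, R be the sets of pendant, quasi-pendant and inner (remaining) vertices, n the order
and m the multiplicity. Since G is reduced, n = 2|P| + |R|. An eigenvector x satisfies ∑_{u ~ v} x_u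
= (deg v − 1) x_v at every v. At a pendant vertex this says that its neighbour is a zero, so x
vanishes on Q, and then its values on R determine it.

Suppose some cycle vertex w is a zero of every eigenvector. Elimination in a spanning tree gives m ≤
|P| (`finrank_le_card_pendant`). Moreover G − w is bipartite, and the values of x on one colour
class of R determine those on the other, so 2m ≤ |R| (`two_mul_finrank_le`). Adding up, 4m ≤ 2|P| +
|R| = n.

Suppose no cycle vertex is a common zero. A discrete Green identity on each tree hanging off the
cycle (`wronskian`) shows that all eigenvectors obey one and the same three-term recurrence along
the cycle. Hence m = r + k, where r ≤ 2 is the rank of x ↦ (x(c 0), x(c 1)) and k is the dimension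
of the space of eigenvectors vanishing on the cycle. With g the cycle length and N the set of
off-cycle vertices adjacent to it, sharpened forms of the two bounds give k ≤ |P| − |N| and 2k ≤ |R|
− g − |N ∩ R|. So 4m < n unless r = 2 and g + 2|N| + |N ∩ R| ≤ 8. When r = 2 every solution of the
recurrence is g-periodic, which excludes these small cases (`nine_le_of_recurrence`).

In case of equality the common zero lies in Q, m = |P| and |R| = 2m, and arbitrary values on a
colour class of R extend to an eigenvector. This rigidity forces R to induce a perfect matching of
vertices of degree 2. Degree counting and the absence of a pendant P₃ then make Q independent and
cubic, and the graph can be read off along the cycle. Conversely, explicit eigenvectors give m ≥ t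
for the extremal graph. -/

namespace ReducedUnicyclic

/-! ### The unique cycle of a unicyclic graph -/

/-- A closed enumeration of the unique cycle of a unicyclic graph, of length `g`. -/
structure IsCycleEnum {V : Type*} (G : SimpleGraph V) (g : ℕ) (c : ℕ → V) : Prop where
  three_le : 3 ≤ g
  periodic : ∀ i, c (i + g) = c i
  inj : ∀ i < g, ∀ j < g, c i = c j → i = j
  adj : ∀ i, G.Adj (c i) (c (i + 1))
  isTree : ∀ i, (G.deleteEdges {s(c i, c (i + 1))}).IsTree

theorem IsCycleEnum.mod {V : Type*} {G : SimpleGraph V} {g : ℕ} {c : ℕ → V}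
    (h : IsCycleEnum G g c) (i : ℕ) : c (i % g) = c i := by
  have : ∀ k j, c (j + g * k) = c j := by
    intro k
    induction k with
    | zero => simp
    | succ k ih => intro j; rw [Nat.mul_succ, ← Nat.add_assoc, h.periodic, ih]
  conv_rhs => rw [← Nat.mod_add_div i g]
  exact (this _ _).symm

theorem IsCycleEnum.eq_iff {V : Type*} {G : SimpleGraph V} {g : ℕ} {c : ℕ → V}
    (h : IsCycleEnum G g c) (i j : ℕ) : c i = c j ↔ i % g = j % g := by
  have hg : 0 < g := by have := h.three_le; omega
  rw [← h.mod i, ← h.mod j]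
  constructor
  · intro e
    exact h.inj _ (Nat.mod_lt _ hg) _ (Nat.mod_lt _ hg) e
  · intro e; rw [e]

/-- Rotation allows any prescribed cycle vertex to play the role of `c 0`. -/
theorem IsCycleEnum.shift {V : Type*} {G : SimpleGraph V} {g : ℕ} {c : ℕ → V}
    (h : IsCycleEnum G g c) (k : ℕ) : IsCycleEnum G g (fun i => c (i + k)) where
  three_le := h.three_le
  periodic i := by
    have := h.periodic (i + k)
    rw [← this]; congr 1; omega
  inj i hi j hj e := by
    have h1 : (i + k) % g = (j + k) % g := (h.eq_iff _ _).1 e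
    have h2 : i ≡ j [MOD g] := Nat.ModEq.add_right_cancel' k h1
    have := h2
    rw [Nat.ModEq, Nat.mod_eq_of_lt hi, Nat.mod_eq_of_lt hj] at this
    exact this
  adj i := by
    have := h.adj (i + k)
    rwa [show i + k + 1 = i + 1 + k by omega] at this
  isTree i := by
    have := h.isTree (i + k)
    rwa [show i + k + 1 = i + 1 + k by omega] at this

theorem IsUnicyclic.exists_isCycleEnum {V : Type*} {G : SimpleGraph V} (hG : IsUnicyclic G) :
    ∃ g c, IsCycleEnum G g c := by
  classical
  obtain ⟨hconn, C, ⟨v, p, hp, hpC⟩, huniq⟩ := hG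
  have h3 : 3 ≤ p.length := hp.three_le_length
  have hpos : 0 < p.length := by omega
  have hsucc : ∀ i, p.getVert ((i + 1) % p.length) = p.getVert (i % p.length + 1) := by
    intro i
    by_cases hi : i % p.length + 1 < p.length
    · rw [Nat.add_mod, Nat.mod_eq_of_lt (show 1 < p.length by omega), Nat.mod_eq_of_lt hi]
    · have hlt := Nat.mod_lt i hpos
      have he : i % p.length + 1 = p.length := by omega
      rw [Nat.add_mod, Nat.mod_eq_of_lt (show 1 < p.length by omega), he, Nat.mod_self]
      simp
  have hadj : ∀ i, G.Adj (p.getVert (i % p.length)) (p.getVert ((i + 1) % p.length)) := by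
    intro i
    rw [hsucc]
    exact p.adj_getVert_succ (Nat.mod_lt _ hpos)
  have hmem : ∀ i, s(p.getVert (i % p.length), p.getVert ((i + 1) % p.length)) ∈ p.edges := by
    intro i
    rw [hsucc]
    have := p.toSubgraph_adj_getVert (Nat.mod_lt i hpos)
    exact (p.mem_edges_toSubgraph).1 this
  refine ⟨p.length, fun i => p.getVert (i % p.length), h3, fun i => by simp, ?_, hadj, ?_⟩
  · intro i hi j hj e
    simp only [Nat.mod_eq_of_lt hi, Nat.mod_eq_of_lt hj] at e
    exact hp.getVert_injOn' (by simp; omega) (by simp; omega) e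
  · intro i
    refine ⟨?_, ?_⟩
    · refine hconn.connected_delete_edge_of_not_isBridge ?_
      intro hb
      exact hb.notMem_edges_of_isCycle hp (hmem i)
    · intro u q hq
      have hle : G.deleteEdges {s(p.getVert (i % p.length), p.getVert ((i + 1) % p.length))} ≤ G :=
        SimpleGraph.deleteEdges_le _
      -- A cycle surviving the deletion would be the unique cycle of `G`, which contains the deleted
      -- edge.
      have h1 := huniq _ ⟨u, q.mapLe hle, hq.mapLe hle, rfl⟩
      have h2 : s(p.getVert (i % p.length), p.getVert ((i + 1) % p.length))
          ∈ (q.mapLe hle).edgeSet := by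
        rw [h1, ← hpC]; exact hmem i
      have h3 : s(p.getVert (i % p.length), p.getVert ((i + 1) % p.length)) ∈ q.edges := by
        simpa using h2
      have h4 := q.edges_subset_edgeSet h3
      simp at h4

/-! ### Rooted trees, and dimension bounds by coordinates -/

/-- A tree rooted at `r` has a depth function and a parent function. -/
theorem exists_depth_parent {V : Type*} {T : SimpleGraph V} (hT : T.IsTree) (r : V) :
    ∃ (d : V → ℕ) (par : V → V),
      (∀ v, v ≠ r → d v = d (par v) + 1 ∧ T.Adj v (par v)) ∧
      ∀ u v, T.Adj u v → (u ≠ r ∧ par u = v) ∨ (v ≠ r ∧ par v = u) := by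
  classical
  choose w hw hwu using fun v => hT.existsUnique_path v r
  have key : ∀ u v, T.Adj u v → (u ≠ r ∧ (w u).snd = v) ∨ (v ≠ r ∧ (w v).snd = u ∧
      (w v).length = (w u).length + 1) := by
    intro u v h
    by_cases hv : v ∈ (w u).support
    · left
      refine ⟨?_, (hT.isAcyclic.eq_snd_of_adj_start (hw u) h hv).symm⟩
      rintro rfl
      have : w u = .nil := (hwu u _ (by simp)).symm
      rw [this] at hv
      simp at hv
      exact h.ne hv.symm
    · right
      -- If `v` is off the path from `u` to the root, prepending the edge gives the path from `v`,
      -- so `u` is the parent of `v`.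
      have hp : (SimpleGraph.Walk.cons h.symm (w u)).IsPath := by
        rw [SimpleGraph.Walk.cons_isPath_iff]; exact ⟨hw u, hv⟩
      have he := hwu v _ hp
      refine ⟨?_, ?_, ?_⟩
      · rintro rfl
        exact hv (SimpleGraph.Walk.end_mem_support _)
      · rw [← he]; simp
      · rw [← he]; simp
  refine ⟨fun v => (w v).length, fun v => (w v).snd, ?_, ?_⟩
  · intro v hv
    have hnil : ¬ (w v).Nil := SimpleGraph.Walk.not_nil_of_ne hv
    have hadj : T.Adj v (w v).snd := (w v).adj_snd hnil
    refine ⟨?_, hadj⟩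
    have ht : w (w v).snd = (w v).tail := (hwu _ _ ((hw v).tail)).symm
    simp only
    rw [ht]
    exact (SimpleGraph.Walk.length_tail_add_one hnil).symm
  · intro u v h
    rcases key u v h with h1 | h1
    · exact Or.inl h1
    · exact Or.inr ⟨h1.1, h1.2.1⟩

theorem finrank_le_card_of_restrict {V : Type*} [Finite V] (K : Submodule ℝ (V → ℝ)) (S : Finset V)
    (h : ∀ x ∈ K, (∀ s ∈ S, x s = 0) → x = 0) : Module.finrank ℝ K ≤ S.card := by
  have := Fintype.ofFinite V
  let f : K →ₗ[ℝ] (S → ℝ) := (LinearMap.funLeft ℝ ℝ (fun s : S => (s : V))).comp K.subtype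
  have hf : Function.Injective f := by
    rw [injective_iff_map_eq_zero]
    rintro ⟨x, hx⟩ h0
    have := h x hx fun s hs => congrFun h0 ⟨s, hs⟩
    simpa using this
  have := LinearMap.finrank_le_finrank_of_injective hf
  simpa using this

/-- Restriction to `S` is injective, and equality of dimensions makes it surjective. Tight
coordinate bounds thus yield eigenvectors with prescribed values. -/
theorem exists_extend_of_card_le {V : Type*} [Finite V] (K : Submodule ℝ (V → ℝ)) (S : Finset V)
    (h : ∀ x ∈ K, (∀ s ∈ S, x s = 0) → x = 0) (hc : S.card ≤ Module.finrank ℝ K) (y : V → ℝ) :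
    ∃ x ∈ K, ∀ s ∈ S, x s = y s := by
  have := Fintype.ofFinite V
  let f : K →ₗ[ℝ] (S → ℝ) := (LinearMap.funLeft ℝ ℝ (fun s : S => (s : V))).comp K.subtype
  have hf : Function.Injective f := by
    rw [injective_iff_map_eq_zero]
    rintro ⟨x, hx⟩ h0
    have := h x hx fun s hs => congrFun h0 ⟨s, hs⟩
    simpa using this
  have hd : Module.finrank ℝ K = Module.finrank ℝ (S → ℝ) := by
    have := LinearMap.finrank_le_finrank_of_injective hf
    simp only [Module.finrank_fintype_fun_eq_card, Fintype.card_coe] at this ⊢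
    omega
  have hs := (LinearMap.injective_iff_surjective_of_finrank_eq_finrank hd).1 hf
  obtain ⟨⟨x, hx⟩, he⟩ := hs (fun s => y s)
  exact ⟨x, hx, fun s hs => congrFun he ⟨s, hs⟩⟩

/-! ### Eigenvectors and the pendant, quasi-pendant and inner vertices -/

/-- The eigenspace of the Laplacian of `G` for the eigenvalue `1`. -/
noncomputable def lapOneSpace {V : Type*} [Fintype V] [DecidableEq V] (G : SimpleGraph V)
    [DecidableRel G.Adj] : Submodule ℝ (V → ℝ) :=
  Module.End.eigenspace (Matrix.toLin' (G.lapMatrix ℝ)) 1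

theorem mem_lapOneSpace {V : Type*} [Fintype V] [DecidableEq V] {G : SimpleGraph V}
    [DecidableRel G.Adj] {x : V → ℝ} :
    x ∈ lapOneSpace G ↔ ∀ v, ∑ u ∈ G.neighborFinset v, x u = ((G.degree v : ℝ) - 1) * x v := by
  rw [lapOneSpace, Module.End.mem_eigenspace_iff, funext_iff]
  refine forall_congr' fun v => ?_
  rw [Matrix.toLin'_apply, SimpleGraph.lapMatrix_mulVec_apply]
  simp only [one_smul]
  constructor <;> intro h <;> linarith

/-- The vertices which are neither pendant nor quasi-pendant. -/
def innerVertices {V : Type*} [Fintype V] [DecidableEq V] (G : SimpleGraph V)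
    [DecidableRel G.Adj] : Finset V :=
  Finset.univ \ (pendantVertices G ∪ quasiPendantVertices G)

section

variable {V : Type*} [Fintype V] [DecidableEq V] {G : SimpleGraph V} [DecidableRel G.Adj]

theorem mem_pendantVertices {u : V} : u ∈ pendantVertices G ↔ G.degree u = 1 := by
  simp [pendantVertices]

theorem mem_quasiPendantVertices {v : V} :
    v ∈ quasiPendantVertices G ↔ ∃ u, u ∈ pendantVertices G ∧ G.Adj u v := by
  simp [quasiPendantVertices]

theorem mem_innerVertices {v : V} :
    v ∈ innerVertices G ↔ v ∉ pendantVertices G ∧ v ∉ quasiPendantVertices G := by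
  simp [innerVertices]

theorem degree_pos_of_connected (hG : G.Connected) (hn : 2 ≤ Fintype.card V) (v : V) :
    0 < G.degree v := by
  have : Nontrivial V := Fintype.one_lt_card_iff_nontrivial.1 hn
  exact hG.preconnected.degree_pos_of_nontrivial v

theorem eq_of_adj_pendant {u v v' : V} (hu : u ∈ pendantVertices G) (h : G.Adj u v)
    (h' : G.Adj u v') : v = v' := by
  rw [mem_pendantVertices, SimpleGraph.degree_eq_one_iff_existsUnique_adj] at hu
  exact hu.unique h h'

/-- A nonempty set of vertices closed under adjacency is everything. -/
theorem mem_of_adj_closed {G : SimpleGraph V} (hG : G.Connected) (S : Set V) {a : V} (ha : a ∈ S)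
    (h : ∀ u ∈ S, ∀ v, G.Adj u v → v ∈ S) (b : V) : b ∈ S := by
  obtain ⟨p⟩ := hG.preconnected a b
  induction p with
  | nil => exact ha
  | cons hadj _ ih => exact ih (h _ ha _ hadj)

theorem not_mem_pendant_of_mem_quasiPendant (hG : G.Connected) (hn : 3 ≤ Fintype.card V) {v : V}
    (hv : v ∈ quasiPendantVertices G) : v ∉ pendantVertices G := by
  intro hp
  obtain ⟨u, hu, huv⟩ := mem_quasiPendantVertices.1 hv
  have hall := mem_of_adj_closed hG {u, v} (a := u) (by simp) (by
    rintro a (rfl | rfl) b hb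
    · right; exact eq_of_adj_pendant hu hb huv
    · left; exact eq_of_adj_pendant hp hb huv.symm)
  have : (Finset.univ : Finset V) ⊆ {u, v} := by
    intro b _
    have := hall b
    simpa using this
  have h1 := Finset.card_le_card this
  have h2 := Finset.card_le_two (a := u) (b := v)
  rw [Finset.card_univ] at h1
  omega

theorem not_mem_inner_of_mem_quasiPendant {v : V} (hv : v ∈ quasiPendantVertices G) :
    v ∉ innerVertices G := fun h => (mem_innerVertices.1 h).2 hv

theorem mem_quasiPendant_of_adj {u v : V} (hu : u ∈ pendantVertices G) (h : G.Adj u v) :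
    v ∈ quasiPendantVertices G := mem_quasiPendantVertices.2 ⟨u, hu, h⟩

theorem two_le_degree (hG : G.Connected) (hn : 3 ≤ Fintype.card V) {v : V}
    (hv : v ∉ pendantVertices G) : 2 ≤ G.degree v := by
  have := degree_pos_of_connected hG (by omega) v
  rw [mem_pendantVertices] at hv
  omega

theorem card_inner (hG : G.Connected) (hn : 3 ≤ Fintype.card V) :
    (pendantVertices G).card + (quasiPendantVertices G).card + (innerVertices G).card =
      Fintype.card V := by
  have hd : Disjoint (pendantVertices G) (quasiPendantVertices G) := by
    rw [Finset.disjoint_right]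
    exact fun v hv => not_mem_pendant_of_mem_quasiPendant hG hn hv
  rw [innerVertices, ← Finset.card_union_of_disjoint hd, Finset.card_univ_sdiff]
  have := Finset.card_le_univ (pendantVertices G ∪ quasiPendantVertices G)
  omega

/-- Sending a pendant vertex to its neighbour maps onto the quasi-pendant vertices; equal
cardinalities make this map injective. -/
theorem IsReducedGraph.pendant_unique (h : IsReducedGraph G) {u u' v : V}
    (hu : u ∈ pendantVertices G) (hu' : u' ∈ pendantVertices G) (huv : G.Adj u v)
    (huv' : G.Adj u' v) : u = u' := by
  have hex : ∀ u, u ∈ pendantVertices G → ∃ v, G.Adj u v := by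
    intro u hu
    rw [mem_pendantVertices, SimpleGraph.degree_eq_one_iff_existsUnique_adj] at hu
    exact hu.exists
  classical
  let nb : V → V := fun u => if h : ∃ v, G.Adj u v then h.choose else u
  have hnb : ∀ u, u ∈ pendantVertices G → G.Adj u (nb u) := by
    intro u hu
    simp only [nb, dif_pos (hex u hu)]
    exact (hex u hu).choose_spec
  have himg : (pendantVertices G).image nb = quasiPendantVertices G := by
    ext v
    simp only [Finset.mem_image, mem_quasiPendantVertices]
    constructor
    · rintro ⟨u, hu, rfl⟩; exact ⟨u, hu, hnb u hu⟩
    · rintro ⟨u, hu, ha⟩; exact ⟨u, hu, eq_of_adj_pendant hu (hnb u hu) ha⟩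
  have hinj := Finset.card_image_iff.1 (show ((pendantVertices G).image nb).card = _ by
    rw [himg]; exact h.symm)
  apply hinj hu hu'
  rw [eq_of_adj_pendant hu (hnb u hu) huv, eq_of_adj_pendant hu' (hnb u' hu') huv']

theorem eq_zero_of_quasiPendant {x : V → ℝ} (hx : x ∈ lapOneSpace G) {v : V}
    (hv : v ∈ quasiPendantVertices G) : x v = 0 := by
  obtain ⟨u, hu, huv⟩ := mem_quasiPendantVertices.1 hv
  have h := mem_lapOneSpace.1 hx u
  have hs : G.neighborFinset u = {v} := by
    ext b
    simp only [SimpleGraph.mem_neighborFinset, Finset.mem_singleton]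
    exact ⟨fun hb => eq_of_adj_pendant hu hb huv, fun hb => hb ▸ huv⟩
  rw [mem_pendantVertices] at hu
  rw [hs, hu] at h
  simpa using h

/-- The equation at a quasi-pendant vertex, itself a zero, recovers the value at its only pendant
neighbour from the other neighbours. -/
theorem eq_zero_of_inner (hG : G.Connected) (hn : 3 ≤ Fintype.card V) (hred : IsReducedGraph G)
    {x : V → ℝ} (hx : x ∈ lapOneSpace G) (h : ∀ v ∈ innerVertices G, x v = 0) : x = 0 := by
  have h1 : ∀ v, v ∉ pendantVertices G → x v = 0 := by
    intro v hv
    by_cases hq : v ∈ quasiPendantVertices G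
    · exact eq_zero_of_quasiPendant hx hq
    · exact h v (mem_innerVertices.2 ⟨hv, hq⟩)
  funext u
  by_cases hu : u ∈ pendantVertices G
  · obtain ⟨q, hq⟩ := (G.degree_pos_iff_exists_adj u).1
      (degree_pos_of_connected hG (by omega) u)
    have he := mem_lapOneSpace.1 hx q
    rw [eq_zero_of_quasiPendant hx (mem_quasiPendant_of_adj hu hq), mul_zero,
      Finset.sum_eq_single u] at he
    · simpa using he
    · intro b hb hbu
      rw [SimpleGraph.mem_neighborFinset] at hb
      apply h1
      intro hbp
      exact hbu (hred.pendant_unique hbp hu hb.symm hq)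
    · intro hne
      exact absurd ((SimpleGraph.mem_neighborFinset _ _ _).2 hq.symm) hne
  · exact h1 u hu

/-! ### The two basic bounds: colour classes and pendant vertices -/

/-- A colour class of the inner vertices outside a common zero set determines an eigenvector. -/
theorem eq_zero_of_colorClass (hG : G.Connected) (hn : 3 ≤ Fintype.card V)
    (hred : IsReducedGraph G) {Z : Finset V} {col : V → Fin 2}
    (hcol : ∀ u v, G.Adj u v → u ∉ Z → v ∉ Z → col u ≠ col v) (b : Fin 2)
    {x : V → ℝ} (hx : x ∈ lapOneSpace G) (hZ : ∀ z ∈ Z, x z = 0)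
    (h : ∀ v ∈ (innerVertices G \ Z).filter (fun v => col v = b), x v = 0) : x = 0 := by
  refine eq_zero_of_inner hG hn hred hx fun v hv => ?_
  by_cases hvZ : v ∈ Z
  · exact hZ v hvZ
  by_cases hb : col v = b
  · exact h v (by simp [hv, hvZ, hb])
  have hvi := mem_innerVertices.1 hv
  -- At an inner vertex of the other colour every neighbour is a zero, so `(deg v - 1) * x v = 0`
  -- with `deg v ≥ 2`.
  have hsum : ∑ u ∈ G.neighborFinset v, x u = 0 := by
    refine Finset.sum_eq_zero fun u hu => ?_
    rw [SimpleGraph.mem_neighborFinset] at hu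
    by_cases huZ : u ∈ Z
    · exact hZ u huZ
    by_cases huq : u ∈ quasiPendantVertices G
    · exact eq_zero_of_quasiPendant hx huq
    have hup : u ∉ pendantVertices G := fun hup => hvi.2 (mem_quasiPendant_of_adj hup hu.symm)
    refine h u ?_
    have h1 := hcol v u hu hvZ huZ
    have h2 : col u = b := by omega
    simp [mem_innerVertices, hup, huq, huZ, h2]
  rw [mem_lapOneSpace.1 hx v] at hsum
  have hd := two_le_degree hG hn hvi.1
  have hd' : (2 : ℝ) ≤ G.degree v := by exact_mod_cast hd
  rcases mul_eq_zero.1 hsum with h0 | h0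
  · linarith
  · exact h0

theorem finrank_le_colorClass (hG : G.Connected) (hn : 3 ≤ Fintype.card V)
    (hred : IsReducedGraph G) {Z : Finset V} {col : V → Fin 2}
    (hcol : ∀ u v, G.Adj u v → u ∉ Z → v ∉ Z → col u ≠ col v) (b : Fin 2)
    {K : Submodule ℝ (V → ℝ)} (hK : K ≤ lapOneSpace G) (hZ : ∀ x ∈ K, ∀ z ∈ Z, x z = 0) :
    Module.finrank ℝ K ≤ ((innerVertices G \ Z).filter (fun v => col v = b)).card :=
  finrank_le_card_of_restrict K _ fun x hx h =>
    eq_zero_of_colorClass hG hn hred hcol b (hK hx) (hZ x hx) h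

theorem card_colorClass (S : Finset V) (col : V → Fin 2) :
    (S.filter (fun v => col v = 0)).card + (S.filter (fun v => col v = 1)).card = S.card := by
  have : S.filter (fun v => col v = 1) = S.filter (fun v => ¬ col v = 0) := by
    refine Finset.filter_congr fun v _ => ?_
    omega
  rw [this]
  exact Finset.card_filter_add_card_filter_not _

theorem two_mul_finrank_le (hG : G.Connected) (hn : 3 ≤ Fintype.card V)
    (hred : IsReducedGraph G) {Z : Finset V} {col : V → Fin 2}
    (hcol : ∀ u v, G.Adj u v → u ∉ Z → v ∉ Z → col u ≠ col v)
    {K : Submodule ℝ (V → ℝ)} (hK : K ≤ lapOneSpace G) (hZ : ∀ x ∈ K, ∀ z ∈ Z, x z = 0) :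
    2 * Module.finrank ℝ K ≤ (innerVertices G \ Z).card := by
  have h0 := finrank_le_colorClass hG hn hred hcol 0 hK hZ
  have h1 := finrank_le_colorClass hG hn hred hcol 1 hK hZ
  have := card_colorClass (innerVertices G \ Z) col
  omega

/-- A 2-colouring of the spanning tree without the edge `c 0 – c 1` is proper on `G` away from `c
0`. -/
theorem IsCycleEnum.exists_coloring {g : ℕ} {c : ℕ → V} (hc : IsCycleEnum G g c) :
    ∃ col : V → Fin 2, ∀ u v, G.Adj u v → u ≠ c 0 → v ≠ c 0 → col u ≠ col v := by
  obtain ⟨col⟩ := (hc.isTree 0).colorable_two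
  refine ⟨col, fun u v huv hu hv => col.valid ?_⟩
  rw [SimpleGraph.deleteEdges_adj]
  refine ⟨huv, ?_⟩
  simp [hu, hv]

/-- An eigenvector vanishing at two consecutive vertices of the cycle and at all pendant vertices
but one is zero. -/
theorem IsCycleEnum.eq_zero_of_pendant {g : ℕ} {c : ℕ → V} (hc : IsCycleEnum G g c)
    (hG : G.Connected) (hn : 3 ≤ Fintype.card V) (r : V) {x : V → ℝ} (hx : x ∈ lapOneSpace G)
    (h0 : x (c 0) = 0) (h1 : x (c 1) = 0) (hp : ∀ u ∈ pendantVertices G, u ≠ r → x u = 0) :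
    x = 0 := by
  obtain ⟨d, par, hpar, hadj⟩ := exists_depth_parent (hc.isTree 0) r
  have hTadj : ∀ u v, G.Adj u v → (x u = 0 ∧ x v = 0) ∨
      (G.deleteEdges {s(c 0, c (0 + 1))}).Adj u v := by
    intro u v huv
    by_cases he : s(u, v) = s(c 0, c 1)
    · left
      rcases Sym2.eq_iff.1 he with ⟨rfl, rfl⟩ | ⟨rfl, rfl⟩
      · exact ⟨h0, h1⟩
      · exact ⟨h1, h0⟩
    · right
      rw [SimpleGraph.deleteEdges_adj]
      exact ⟨huv, by simpa using he⟩
  by_contra hne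
  have hne' : ((Finset.univ : Finset V).filter fun v => x v ≠ 0).Nonempty := by
    obtain ⟨v, hv⟩ := Function.ne_iff.1 hne
    exact ⟨v, by simpa using hv⟩
  -- Take a deepest nonzero vertex. It has a child `z`, since otherwise it would be a pendant vertex
  -- other than `r`; the equation at the zero `z` involves only `v` and deeper vertices. The edge
  -- missing from the tree joins two zeros and is harmless.
  obtain ⟨v, hv, hmax⟩ := Finset.exists_max_image _ d hne'
  simp only [Finset.mem_filter, Finset.mem_univ, true_and] at hv hmax
  have hchild : ∃ z, z ≠ r ∧ par z = v := by
    by_contra hno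
    push Not at hno
    have hnb : ∀ z, G.Adj v z → v ≠ r ∧ par v = z := by
      intro z hz
      rcases hTadj v z hz with h | h
      · exact absurd h.1 hv
      rcases hadj v z h with h | h
      · exact h
      · exact absurd h.2 (hno z h.1)
    obtain ⟨z, hz⟩ := (G.degree_pos_iff_exists_adj v).1
      (degree_pos_of_connected hG (by omega) v)
    refine hv (hp v ?_ (hnb z hz).1)
    rw [mem_pendantVertices, SimpleGraph.degree_eq_one_iff_existsUnique_adj]
    exact ⟨z, hz, fun y hy => by rw [← (hnb z hz).2, ← (hnb y hy).2]⟩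
  obtain ⟨z, hzr, hz⟩ := hchild
  have hdz := hpar z hzr
  rw [hz] at hdz
  have hxz : x z = 0 := by
    by_contra h
    have := hmax z h
    omega
  have he := mem_lapOneSpace.1 hx z
  rw [hxz, mul_zero, Finset.sum_eq_single v] at he
  · exact hv he
  · intro u hu huv
    rw [SimpleGraph.mem_neighborFinset] at hu
    rcases hTadj z u hu with h | h
    · exact h.2
    rcases hadj z u h with h | ⟨hur, hu'⟩
    · exact absurd (h.2.symm.trans hz) huv
    · by_contra h
      have h3 := hmax u h
      have h4 := (hpar u hur).1
      rw [hu'] at h4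
      omega
  · intro hnm
    refine absurd ?_ hnm
    rw [SimpleGraph.mem_neighborFinset]
    exact SimpleGraph.deleteEdges_le _ hdz.2

theorem IsCycleEnum.finrank_le_two {g : ℕ} {c : ℕ → V} (hc : IsCycleEnum G g c)
    (hG : G.Connected) (hn : 3 ≤ Fintype.card V) (hp : pendantVertices G = ∅) :
    Module.finrank ℝ (lapOneSpace G) ≤ 2 := by
  refine (finrank_le_card_of_restrict _ {c 0, c 1} fun x hx h => ?_).trans Finset.card_le_two
  exact hc.eq_zero_of_pendant hG hn (c 0) hx (h _ (by simp)) (h _ (by simp)) (by simp [hp])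

/-- As `c 0` is a zero for free, `c 1` and all pendant vertices but one suffice as coordinates. -/
theorem IsCycleEnum.finrank_le_card_pendant {g : ℕ} {c : ℕ → V} (hc : IsCycleEnum G g c)
    (hG : G.Connected) (hn : 3 ≤ Fintype.card V) (hp : (pendantVertices G).Nonempty)
    (h0 : ∀ x ∈ lapOneSpace G, x (c 0) = 0) :
    Module.finrank ℝ (lapOneSpace G) ≤ (pendantVertices G).card := by
  obtain ⟨r, hr⟩ := hp
  refine (finrank_le_card_of_restrict _ (insert (c 1) ((pendantVertices G).erase r))
    fun x hx h => ?_).trans ?_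
  · exact hc.eq_zero_of_pendant hG hn r hx (h0 x hx) (h _ (by simp))
      fun u hu hur => h u (by simp [hu, hur])
  · refine (Finset.card_insert_le _ _).trans ?_
    rw [Finset.card_erase_add_one hr]

end

/-! ### The trees hanging off the cycle -/

/-- The set of vertices of the cycle enumerated by `c`. -/
def cycleVertices {V : Type*} [DecidableEq V] (g : ℕ) (c : ℕ → V) : Finset V :=
  (Finset.range g).image c

/-- The neighbours of `v` outside the cycle enumerated by `c`. -/
def offCycleNbrs {V : Type*} [Fintype V] [DecidableEq V] (G : SimpleGraph V) [DecidableRel G.Adj]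
    (g : ℕ) (c : ℕ → V) (v : V) : Finset V :=
  G.neighborFinset v \ cycleVertices g c

/-- The vertices outside the cycle enumerated by `c` with a neighbour on the cycle. -/
def cycleBoundary {V : Type*} [Fintype V] [DecidableEq V] (G : SimpleGraph V) [DecidableRel G.Adj]
    (g : ℕ) (c : ℕ → V) : Finset V :=
  Finset.univ.filter fun v => v ∉ cycleVertices g c ∧ ∃ w ∈ cycleVertices g c, G.Adj v w

/-- Depth and parent functions for the spanning tree of a unicyclic graph obtained by deleting
the edge `c 0 – c 1` of the cycle, rooted at `c 0`. -/
structure IsRooting {V : Type*} (G : SimpleGraph V) (g : ℕ) (c : ℕ → V) (d : V → ℕ)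
    (par : V → V) : Prop where
  root : par (c 0) = c 0
  depth : ∀ v, v ≠ c 0 → d v = d (par v) + 1
  adj : ∀ v, v ≠ c 0 → G.Adj v (par v)
  of_adj : ∀ u v, G.Adj u v →
    (u ≠ c 0 ∧ par u = v) ∨ (v ≠ c 0 ∧ par v = u) ∨ s(u, v) = s(c 0, c 1)
  cycle : ∀ i, 1 ≤ i → i < g → par (c i) = c (i + 1)

section

variable {V : Type*} [Fintype V] [DecidableEq V] {G : SimpleGraph V} [DecidableRel G.Adj]
  {g : ℕ} {c : ℕ → V} {d : V → ℕ} {par : V → V}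

theorem IsCycleEnum.mem_cycleVertices (hc : IsCycleEnum G g c) {v : V} :
    v ∈ cycleVertices g c ↔ ∃ i, c i = v := by
  simp only [cycleVertices, Finset.mem_image, Finset.mem_range]
  constructor
  · rintro ⟨i, -, rfl⟩; exact ⟨i, rfl⟩
  · rintro ⟨i, rfl⟩
    exact ⟨i % g, Nat.mod_lt _ (by have := hc.three_le; omega), hc.mod i⟩

theorem IsCycleEnum.apply_mem (hc : IsCycleEnum G g c) (i : ℕ) : c i ∈ cycleVertices g c :=
  hc.mem_cycleVertices.2 ⟨i, rfl⟩

theorem IsCycleEnum.card_cycleVertices (hc : IsCycleEnum G g c) : (cycleVertices g c).card = g := by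
  rw [cycleVertices, Finset.card_image_of_injOn, Finset.card_range]
  intro i hi j hj e
  exact hc.inj i (by simpa using hi) j (by simpa using hj) e

theorem IsCycleEnum.succ_eq_iff (hc : IsCycleEnum G g c) (i j : ℕ) :
    c (i + 1) = c (j + 1) ↔ c i = c j := by
  rw [hc.eq_iff, hc.eq_iff]
  exact ⟨fun h => Nat.ModEq.add_right_cancel' (n := g) 1 h,
    fun h => Nat.ModEq.add_right (n := g) 1 h⟩

theorem IsCycleEnum.ne_add_two (hc : IsCycleEnum G g c) (i : ℕ) : c i ≠ c (i + 2) := by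
  have h3 := hc.three_le
  rw [Ne, hc.eq_iff]
  intro h
  have : 0 ≡ 2 [MOD g] := Nat.ModEq.add_left_cancel' (n := g) i h
  rw [Nat.ModEq, Nat.zero_mod, Nat.mod_eq_of_lt (by omega)] at this
  omega

theorem IsCycleEnum.exists_rooting (hc : IsCycleEnum G g c) : ∃ d par, IsRooting G g c d par := by
  have h3 := hc.three_le
  obtain ⟨d, par, hpar, hadj⟩ := exists_depth_parent (hc.isTree 0) (c 0)
  -- Induction on the distance `k + 1` to the root `c g = c 0`: without the edge `c 0 – c 1` the
  -- cycle is a path climbing from `c 1` to the root.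
  have hcyc : ∀ k i, 1 ≤ i → i + k + 1 = g → par (c i) = c (i + 1) := by
    have hT : ∀ i, 1 ≤ i → i < g →
        (G.deleteEdges {s(c 0, c (0 + 1))}).Adj (c i) (c (i + 1)) := by
      intro i hi hig
      rw [SimpleGraph.deleteEdges_adj]
      refine ⟨hc.adj i, fun he => ?_⟩
      rcases Sym2.eq_iff.1 (Set.mem_singleton_iff.1 he) with ⟨h1, h2⟩ | ⟨h1, h2⟩
      · have := hc.inj i hig 0 (by omega) h1
        omega
      · have h4 := hc.inj i hig (0 + 1) (by omega) h1
        subst h4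
        have := hc.inj _ (by omega) 0 (by omega) h2
        omega
    intro k
    induction k with
    | zero =>
      intro i hi hig
      have hz : c (i + 1) = c 0 := by
        have := hc.periodic 0
        rw [← this]; congr 1; omega
      rcases hadj _ _ (hT i hi (by omega)) with h | h
      · exact h.2
      · exact absurd hz h.1
    | succ k ih =>
      intro i hi hig
      rcases hadj _ _ (hT i hi (by omega)) with h | h
      · exact h.2
      · have h1 := ih (i + 1) (by omega) (by omega)
        rw [h1] at h
        exact absurd h.2.symm (hc.ne_add_two i)
  refine ⟨d, fun v => if v = c 0 then c 0 else par v, ⟨by simp, ?_, ?_, ?_, ?_⟩⟩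
  · intro v hv
    simp only [if_neg hv]
    exact (hpar v hv).1
  · intro v hv
    simp only [if_neg hv]
    exact SimpleGraph.deleteEdges_le _ (hpar v hv).2
  · intro u v huv
    by_cases he : s(u, v) = s(c 0, c 1)
    · exact Or.inr (Or.inr he)
    · rcases hadj u v (by
        rw [SimpleGraph.deleteEdges_adj]; exact ⟨huv, by simpa using he⟩) with h | h
      · left; simp only [if_neg h.1]; exact h
      · right; left; simp only [if_neg h.1]; exact h
  · intro i hi hig
    have h0 : c i ≠ c 0 := fun h => by
      have := hc.inj i hig 0 (by omega) h
      omega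
    simp only [if_neg h0]
    exact hcyc (g - i - 1) i hi (by omega)

theorem IsRooting.par_mem (hr : IsRooting G g c d par) (hc : IsCycleEnum G g c) {v : V}
    (hv : v ∈ cycleVertices g c) : par v ∈ cycleVertices g c := by
  obtain ⟨i, hi, rfl⟩ := Finset.mem_image.1 hv
  rcases Nat.eq_zero_or_pos i with rfl | h
  · rw [hr.root]; exact hv
  · rw [hr.cycle i h (by simpa using hi)]; exact hc.apply_mem _

/-- Parents of cycle vertices stay on the cycle. In particular an off-cycle vertex has at most one
neighbour on it. -/
theorem IsRooting.par_eq (hr : IsRooting G g c d par) (hc : IsCycleEnum G g c) {y w : V}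
    (hy : y ∉ cycleVertices g c) (hw : w ∈ cycleVertices g c) (h : G.Adj y w) : par y = w := by
  rcases hr.of_adj y w h with h | h | h
  · exact h.2
  · exact absurd (h.2 ▸ hr.par_mem hc hw) hy
  · rcases Sym2.eq_iff.1 h with ⟨rfl, -⟩ | ⟨rfl, -⟩
    · exact absurd (hc.apply_mem 0) hy
    · exact absurd (hc.apply_mem 1) hy

/-- The cycle has no chord, because each edge but `c 0 – c 1` joins a vertex to its parent. -/
theorem IsCycleEnum.eq_of_adj (hc : IsCycleEnum G g c) {i j : ℕ} (h : G.Adj (c i) (c j)) :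
    c j = c (i + 1) ∨ c i = c (j + 1) := by
  obtain ⟨d, par, hr⟩ := hc.exists_rooting
  have h3 := hc.three_le
  have hpar : ∀ i, c i ≠ c 0 → par (c i) = c (i + 1) := by
    intro i hi
    have h1 : 1 ≤ i % g := by
      by_contra h0
      have h2 : i % g = 0 := by omega
      rw [← hc.mod i, h2] at hi
      exact hi rfl
    rw [← hc.mod i, hr.cycle _ h1 (Nat.mod_lt _ (by omega)), hc.succ_eq_iff, hc.mod]
  rcases hr.of_adj _ _ h with h | h | h
  · left; rw [← hpar i h.1, h.2]
  · right; rw [← hpar j h.1, h.2]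
  · rcases Sym2.eq_iff.1 h with ⟨h1, h2⟩ | ⟨h1, h2⟩
    · left; rw [h2]; exact ((hc.succ_eq_iff i 0).2 h1).symm
    · right; rw [h1]; exact ((hc.succ_eq_iff j 0).2 h2).symm

theorem IsCycleEnum.neighborFinset_eq (hc : IsCycleEnum G g c) (i : ℕ) :
    G.neighborFinset (c (i + 1)) =
      insert (c i) (insert (c (i + 2)) (offCycleNbrs G g c (c (i + 1)))) := by
  ext v
  simp only [offCycleNbrs, Finset.mem_insert, Finset.mem_sdiff, SimpleGraph.mem_neighborFinset]
  constructor
  · intro h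
    by_cases hv : v ∈ cycleVertices g c
    · obtain ⟨j, rfl⟩ := hc.mem_cycleVertices.1 hv
      rcases hc.eq_of_adj h with h | h
      · exact Or.inr (Or.inl h)
      · exact Or.inl ((hc.succ_eq_iff i j).1 h).symm
    · exact Or.inr (Or.inr ⟨h, hv⟩)
  · rintro (rfl | rfl | h)
    · exact (hc.adj i).symm
    · exact hc.adj (i + 1)
    · exact h.1

theorem IsCycleEnum.not_mem_offCycleNbrs (hc : IsCycleEnum G g c) (i : ℕ) (v : V) :
    c i ∉ offCycleNbrs G g c v := by
  simp [offCycleNbrs, hc.apply_mem i]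

theorem IsCycleEnum.sum_neighborFinset (hc : IsCycleEnum G g c) (i : ℕ) (x : V → ℝ) :
    ∑ u ∈ G.neighborFinset (c (i + 1)), x u =
      x (c i) + (x (c (i + 2)) + ∑ u ∈ offCycleNbrs G g c (c (i + 1)), x u) := by
  rw [hc.neighborFinset_eq, Finset.sum_insert, Finset.sum_insert (hc.not_mem_offCycleNbrs _ _)]
  simp [hc.ne_add_two i, hc.not_mem_offCycleNbrs]

theorem IsCycleEnum.degree_eq (hc : IsCycleEnum G g c) (i : ℕ) :
    G.degree (c (i + 1)) = (offCycleNbrs G g c (c (i + 1))).card + 2 := by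
  rw [← SimpleGraph.card_neighborFinset_eq_degree, hc.neighborFinset_eq, Finset.card_insert_of_notMem,
    Finset.card_insert_of_notMem (hc.not_mem_offCycleNbrs _ _)]
  simp [hc.ne_add_two i, hc.not_mem_offCycleNbrs]

theorem IsCycleEnum.exists_succ (hc : IsCycleEnum G g c) {v : V} (hv : v ∈ cycleVertices g c) :
    ∃ i, c (i + 1) = v := by
  obtain ⟨i, rfl⟩ := hc.mem_cycleVertices.1 hv
  have h3 := hc.three_le
  refine ⟨i + g - 1, ?_⟩
  rw [← hc.periodic i]; congr 1; omega

theorem IsCycleEnum.not_pendant (hc : IsCycleEnum G g c) {v : V} (hv : v ∈ cycleVertices g c) :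
    v ∉ pendantVertices G := by
  obtain ⟨i, rfl⟩ := hc.exists_succ hv
  rw [mem_pendantVertices, hc.degree_eq]
  omega

theorem IsCycleEnum.mem_cycleBoundary (hc : IsCycleEnum G g c) {i : ℕ} {y : V}
    (hy : y ∈ offCycleNbrs G g c (c i)) : y ∈ cycleBoundary G g c := by
  simp only [offCycleNbrs, Finset.mem_sdiff, SimpleGraph.mem_neighborFinset] at hy
  simp only [cycleBoundary, Finset.mem_filter, Finset.mem_univ, true_and]
  exact ⟨hy.2, c i, hc.apply_mem i, hy.1.symm⟩

/-! ### The Wronskian and the recurrence along the cycle -/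

/-- Two eigenvectors are proportional along an edge leaving the cycle. -/
theorem IsCycleEnum.wronskian (hc : IsCycleEnum G g c) {y w : V} (hy : y ∉ cycleVertices g c)
    (hw : w ∈ cycleVertices g c) (h : G.Adj y w) {x z : V → ℝ} (hx : x ∈ lapOneSpace G)
    (hz : z ∈ lapOneSpace G) : x y * z w = z y * x w := by
  classical
  obtain ⟨d, par, hr⟩ := hc.exists_rooting
  -- The descendants of `y`; the only edge leaving `D` is `y – w`.
  let D : Finset V := Finset.univ.filter fun v => ∃ k, par^[k] v = y
  have hD : ∀ v, v ∈ D ↔ ∃ k, par^[k] v = y := by simp [D]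
  have hDC : ∀ v ∈ D, v ∉ cycleVertices g c := by
    intro v hv hvc
    obtain ⟨k, hk⟩ := (hD v).1 hv
    have : ∀ k, par^[k] v ∈ cycleVertices g c := by
      intro k
      induction k with
      | zero => exact hvc
      | succ k ih => rw [Function.iterate_succ_apply']; exact hr.par_mem hc ih
    exact hy (hk ▸ this k)
  have hyD : y ∈ D := (hD y).2 ⟨0, rfl⟩
  have hwD : w ∉ D := fun h' => hDC w h' hw
  have hout : ∀ u ∈ D, ∀ v, v ∉ D → G.Adj u v → u = y ∧ v = w := by
    intro u hu v hv huv
    rcases hr.of_adj u v huv with ⟨-, h1⟩ | ⟨-, h1⟩ | h1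
    · obtain ⟨k, hk⟩ := (hD u).1 hu
      cases k with
      | zero =>
        simp only [Function.iterate_zero, id] at hk
        subst hk
        exact ⟨rfl, by rw [← h1]; exact hr.par_eq hc hy hw h⟩
      | succ k =>
        rw [Function.iterate_succ_apply, h1] at hk
        exact absurd ((hD v).2 ⟨k, hk⟩) hv
    · obtain ⟨k, hk⟩ := (hD u).1 hu
      exact absurd ((hD v).2 ⟨k + 1, by rw [Function.iterate_succ_apply, h1, hk]⟩) hv
    · exfalso
      apply hDC u hu
      rcases Sym2.eq_iff.1 h1 with ⟨rfl, -⟩ | ⟨rfl, -⟩ <;> exact hc.apply_mem _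
  -- A flow: antisymmetric, and conserved at each vertex because both vectors have the same
  -- eigenvalue. Its net outflow from `D`, carried by the single edge `y – w`, is therefore zero.
  let F : V → V → ℝ := fun v u => if G.Adj v u then x u * z v - x v * z u else 0
  have hrow : ∀ v, ∑ u, F v u = 0 := by
    intro v
    have h1 := mem_lapOneSpace.1 hx v
    have h2 := mem_lapOneSpace.1 hz v
    have h3 : ∑ u, F v u = ∑ u ∈ G.neighborFinset v, (x u * z v - x v * z u) := by
      rw [← Finset.sum_filter]
      refine Finset.sum_congr ?_ fun _ _ => rfl
      ext; simp
    rw [h3, Finset.sum_sub_distrib, ← Finset.sum_mul, ← Finset.mul_sum, h1, h2]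
    ring
  have hanti : ∀ v u, F v u = -F u v := by
    intro v u
    simp only [F, G.adj_comm u v]
    split_ifs <;> ring
  have htot : ∑ v ∈ D, ∑ u ∈ D, F v u = 0 := by
    have h1 : ∑ v ∈ D, ∑ u ∈ D, F v u = -∑ v ∈ D, ∑ u ∈ D, F v u := by
      conv_lhs => rw [Finset.sum_comm]
      rw [← Finset.sum_neg_distrib]
      refine Finset.sum_congr rfl fun u _ => ?_
      rw [← Finset.sum_neg_distrib]
      exact Finset.sum_congr rfl fun v _ => hanti v u
    linarith
  have hcomp : ∑ v ∈ D, ∑ u ∈ Dᶜ, F v u = x w * z y - x y * z w := by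
    rw [Finset.sum_eq_single_of_mem y hyD, Finset.sum_eq_single_of_mem w (by simpa using hwD)]
    · simp [F, h]
    · intro u hu huw
      simp only [F]
      rw [if_neg fun h' => huw (hout y hyD u (by simpa using hu) h').2]
    · intro v hv hvy
      refine Finset.sum_eq_zero fun u hu => ?_
      simp only [F]
      rw [if_neg fun h' => hvy (hout v hv u (by simpa using hu) h').1]
  have hsum : ∑ v ∈ D, ∑ u ∈ D, F v u + ∑ v ∈ D, ∑ u ∈ Dᶜ, F v u = 0 := by
    rw [← Finset.sum_add_distrib]
    refine Finset.sum_eq_zero fun v _ => ?_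
    rw [Finset.sum_add_sum_compl, hrow]
  rw [htot, hcomp] at hsum
  linarith

/-- An eigenvector satisfies a three-term recurrence along the cycle. -/
theorem IsCycleEnum.exists_recurrence (hc : IsCycleEnum G g c)
    {i : ℕ} (hi : ∃ z ∈ lapOneSpace G, z (c (i + 1)) ≠ 0) :
    ∃ δ : ℝ, (∀ x ∈ lapOneSpace G, x (c i) + x (c (i + 2)) = δ * x (c (i + 1))) ∧
      ((offCycleNbrs G g c (c (i + 1)) ∩ innerVertices G).card = 0 →
        δ = 1 + (offCycleNbrs G g c (c (i + 1))).card) := by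
  obtain ⟨z, hz, hz0⟩ := hi
  have hw := hc.apply_mem (i + 1)
  have heq : ∀ x ∈ lapOneSpace G, x (c i) + (x (c (i + 2)) +
      ∑ u ∈ offCycleNbrs G g c (c (i + 1)), x u) =
      ((offCycleNbrs G g c (c (i + 1))).card + 1) * x (c (i + 1)) := by
    intro x hx
    have := mem_lapOneSpace.1 hx (c (i + 1))
    rw [hc.sum_neighborFinset, hc.degree_eq] at this
    rw [this]; push_cast; ring
  -- The ratio for one eigenvector nonzero at `c (i + 1)`; the Wronskian identity makes it valid for
  -- all. If no off-cycle neighbour is inner, all of them are quasi-pendant zeros and the degree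
  -- alone gives `δ`.
  refine ⟨(z (c i) + z (c (i + 2))) / z (c (i + 1)), fun x hx => ?_, fun h0 => ?_⟩
  · have h1 := heq x hx
    have h2 := heq z hz
    have h3 : (∑ u ∈ offCycleNbrs G g c (c (i + 1)), x u) * z (c (i + 1)) =
        (∑ u ∈ offCycleNbrs G g c (c (i + 1)), z u) * x (c (i + 1)) := by
      rw [Finset.sum_mul, Finset.sum_mul]
      refine Finset.sum_congr rfl fun y hy => ?_
      simp only [offCycleNbrs, Finset.mem_sdiff, SimpleGraph.mem_neighborFinset] at hy
      exact hc.wronskian hy.2 hw hy.1.symm hx hz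
    field_simp
    linear_combination (z (c (i + 1))) * h1 - x (c (i + 1)) * h2 - h3
  · have h2 := heq z hz
    have hs : ∑ u ∈ offCycleNbrs G g c (c (i + 1)), z u = 0 := by
      refine Finset.sum_eq_zero fun y hy => ?_
      by_cases hyq : y ∈ quasiPendantVertices G
      · exact eq_zero_of_quasiPendant hz hyq
      have hadj : G.Adj (c (i + 1)) y := by
        simp only [offCycleNbrs, Finset.mem_sdiff, SimpleGraph.mem_neighborFinset] at hy
        exact hy.1
      have hyp : y ∉ pendantVertices G := fun hyp =>
        hz0 (eq_zero_of_quasiPendant hz (mem_quasiPendant_of_adj hyp hadj.symm))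
      rw [Finset.card_eq_zero] at h0
      have : y ∈ offCycleNbrs G g c (c (i + 1)) ∩ innerVertices G :=
        Finset.mem_inter.2 ⟨hy, mem_innerVertices.2 ⟨hyp, hyq⟩⟩
      rw [h0] at this
      simp at this
    rw [hs] at h2
    rw [div_eq_iff hz0]
    linarith

end

/-! ### Periodic three-term recurrences -/

/-- A three-term recurrence all of whose solutions are `g`-periodic forces `g` to be large or
the coefficients to be far from `1`. -/
theorem nine_le_of_recurrence {g : ℕ} (hg : 3 ≤ g) {δ : ℕ → ℝ} {b t : ℕ → ℕ}
    (htb : ∀ i, t i ≤ b i) (hδ : ∀ i, t i = 0 → δ i = 1 + b i) {X Z : ℕ → ℝ}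
    (hXp : ∀ i, X (i + g) = X i) (hZp : ∀ i, Z (i + g) = Z i)
    (hX : ∀ i, X i + X (i + 2) = δ i * X (i + 1)) (hZ : ∀ i, Z i + Z (i + 2) = δ i * Z (i + 1))
    (hX0 : X 0 = 1) (hX1 : X 1 = 0) (hZ0 : Z 0 = 0) (hZ1 : Z 1 = 1)
    (hb : ∃ i < g, b i ≠ 0) : 9 ≤ g + ∑ i ∈ Finset.range g, (2 * b i + t i) := by
  have hone : ∀ i, t i = 0 → 1 ≤ δ i := fun i h => by
    rw [hδ i h]
    have : (0 : ℝ) ≤ b i := Nat.cast_nonneg _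
    linarith
  have hpos : ∀ i, δ i < 1 → 1 ≤ t i := fun i h => by
    by_contra h0
    have := hone i (by omega)
    linarith
  have hX2 : X 2 = -1 := by have := hX 0; norm_num [hX0, hX1] at this; linarith
  have hX3 : X 3 = -δ 1 := by have := hX 1; norm_num [hX2, hX1] at this; linarith
  have hX4 : X 4 = 1 - δ 1 * δ 2 := by have := hX 2; norm_num [hX2, hX3] at this; linarith
  have hZ2 : Z 2 = δ 0 := by have := hZ 0; norm_num [hZ0, hZ1] at this; linarith
  have hZ3 : Z 3 = δ 0 * δ 1 - 1 := by have := hZ 1; norm_num [hZ2, hZ1] at this; linarith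
  by_contra hlt
  push Not at hlt
  have hS : 2 ≤ ∑ i ∈ Finset.range g, (2 * b i + t i) := by
    obtain ⟨i, hi, hbi⟩ := hb
    have := Finset.single_le_sum (f := fun i => 2 * b i + t i) (fun _ _ => Nat.zero_le _)
      (Finset.mem_range.2 hi)
    omega
  have hg6 : g ≤ 6 := by omega
  -- A coefficient below 1 forces `t i ≥ 1`, hence costs at least 3 in the sum. Periodicity gives
  -- polynomial identities in the `δ i` for each length.
  interval_cases g
  -- For `g = 3` all three coefficients equal -1, costing 9.
  · have e3 := hXp 0
    have e4 := hXp 1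
    have f3 := hZp 0
    norm_num at e3 e4 f3
    have k2 := hX 2
    norm_num [hX2] at k2
    rw [e3, e4, hX0, hX1] at k2
    have d1 : δ 1 = -1 := by rw [hX3, hX0] at e3; linarith
    have d0 : δ 0 = -1 := by rw [hZ3, hZ0, d1] at f3; linarith
    have t0 := hpos 0 (by rw [d0]; norm_num)
    have t1 := hpos 1 (by rw [d1]; norm_num)
    have t2 := hpos 2 (by linarith)
    have := htb 0; have := htb 1; have := htb 2
    simp only [Finset.sum_range_succ, Finset.sum_range_zero] at hlt
    omega
  -- For `g = 4` opposite coefficients sum to 0, so each opposite pair costs at least 3.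
  · have e4 := hXp 0
    have e5 := hXp 1
    have f4 := hZp 0
    have f5 := hZp 1
    norm_num at e4 e5 f4 f5
    have k3 := hX 3
    have l2 := hZ 2
    have l3 := hZ 3
    norm_num at k3 l2 l3
    rw [e4, e5, hX0, hX1, hX3] at k3
    rw [f4, hZ0, hZ2, hZ3] at l2
    rw [f4, f5, hZ0, hZ1, hZ3] at l3
    have s13 : δ 1 + δ 3 = 0 := by linarith
    have s02 : δ 0 + δ 2 = 0 := by
      have : δ 0 * δ 1 = 0 := by linarith
      rw [this] at l2; linarith
    have h1 : 1 ≤ t 1 ∨ 1 ≤ t 3 := by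
      by_contra h
      have := hone 1 (by omega); have := hone 3 (by omega)
      linarith
    have h2 : 1 ≤ t 0 ∨ 1 ≤ t 2 := by
      by_contra h
      have := hone 0 (by omega); have := hone 2 (by omega)
      linarith
    have := htb 0; have := htb 1; have := htb 2; have := htb 3
    simp only [Finset.sum_range_succ, Finset.sum_range_zero] at hlt
    omega
  -- For `g = 5` each relation `δ i * δ j + δ k = 1` needs a coefficient below 1. The three triples
  -- have no common index, so at least two are needed.
  · have e5 := hXp 0
    have e6 := hXp 1
    have f5 := hZp 0
    have f6 := hZp 1
    norm_num at e5 e6 f5 f6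
    have k4 := hX 4
    have l2 := hZ 2
    have l3 := hZ 3
    have l4 := hZ 4
    norm_num at k4 l2 l3 l4
    rw [e5, e6, hX0, hX1, hX4] at k4
    have hZ4 : Z 4 = -1 := by rw [f5, f6, hZ0, hZ1] at l4; linarith
    rw [hZ4, hZ2, hZ3] at l2
    rw [hZ4, f5, hZ0, hZ3] at l3
    have r1 : δ 1 * δ 2 + δ 4 = 1 := by linarith
    have r2 : δ 0 * δ 1 + δ 3 = 1 := by linarith
    have r3 : δ 2 * δ 3 + δ 0 = 1 := by linear_combination l2 + δ 2 * r2
    have aux : ∀ i j k, δ i * δ j + δ k = 1 → 1 ≤ t i ∨ 1 ≤ t j ∨ 1 ≤ t k := by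
      intro i j k h
      by_contra h0
      have := hone i (by omega); have := hone j (by omega); have := hone k (by omega)
      nlinarith
    have := aux _ _ _ r1; have := aux _ _ _ r2; have := aux _ _ _ r3
    have := htb 0; have := htb 1; have := htb 2; have := htb 3; have := htb 4
    simp only [Finset.sum_range_succ, Finset.sum_range_zero] at hlt
    omega
  -- For `g = 6` the sum is at most 2, so every `t i` is 0 and every `δ i ≥ 1`. The relations below
  -- force `δ i = 1` and `b i = 0` throughout, against `hb`.
  · have e6 := hXp 0
    have e7 := hXp 1
    have f6 := hZp 0
    have f7 := hZp 1
    norm_num at e6 e7 f6 f7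
    have k3 := hX 3
    have k4 := hX 4
    have k5 := hX 5
    have l3 := hZ 3
    have l4 := hZ 4
    have l5 := hZ 5
    norm_num at k3 k4 k5 l3 l4 l5
    have ht : ∀ i, i < 6 → t i = 0 := by
      intro i hi
      have h1 := Finset.single_le_sum (f := fun i => 2 * b i + t i) (fun _ _ => Nat.zero_le _)
        (Finset.mem_range.2 hi)
      have h2 := htb i
      omega
    have d0 := hone 0 (ht 0 (by norm_num))
    have d1 := hone 1 (ht 1 (by norm_num))
    have d2 := hone 2 (ht 2 (by norm_num))
    have d3 := hone 3 (ht 3 (by norm_num))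
    have d4 := hone 4 (ht 4 (by norm_num))
    have d5 := hone 5 (ht 5 (by norm_num))
    have hX5 : X 5 = δ 5 := by rw [e6, e7, hX0, hX1] at k5; linarith
    rw [hX4, e6, hX0, hX5] at k4
    have hZ5 : Z 5 = -1 := by rw [f6, f7, hZ0, hZ1] at l5; linarith
    have hZ4 : Z 4 = -δ 4 := by rw [hZ5, f6, hZ0] at l4; linarith
    rw [hZ3, hZ4, hZ5] at l3
    have p1 : δ 1 * δ 2 + δ 4 * δ 5 = 2 := by linarith
    have p2 : δ 0 * δ 1 + δ 3 * δ 4 = 2 := by linarith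
    have z : ∀ i, t i = 0 → δ i ≤ 1 → b i = 0 := by
      intro i h h'
      rw [hδ i h] at h'
      have : (b i : ℝ) ≤ 0 := by linarith
      exact_mod_cast le_antisymm this (Nat.cast_nonneg _)
    have hm : ∀ a a' : ℝ, 1 ≤ a → 1 ≤ a' → 1 ≤ a * a' := fun a a' h h' =>
      one_le_mul_of_one_le_of_one_le h h'
    have hle : ∀ a a' : ℝ, 1 ≤ a → 1 ≤ a' → a * a' ≤ 1 → a ≤ 1 ∧ a' ≤ 1 := fun a a' h h' h'' =>
      ⟨(le_mul_of_one_le_right (by linarith) h').trans h'',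
        (le_mul_of_one_le_left (by linarith) h).trans h''⟩
    have q1 := hle _ _ d1 d2 (by linarith [hm _ _ d4 d5])
    have q2 := hle _ _ d4 d5 (by linarith [hm _ _ d1 d2])
    have q3 := hle _ _ d0 d1 (by linarith [hm _ _ d3 d4])
    have q4 := hle _ _ d3 d4 (by linarith [hm _ _ d0 d1])
    have b0 := z 0 (ht 0 (by norm_num)) q3.1
    have b1 := z 1 (ht 1 (by norm_num)) q1.1
    have b2 := z 2 (ht 2 (by norm_num)) q1.2
    have b3 := z 3 (ht 3 (by norm_num)) q4.1
    have b4 := z 4 (ht 4 (by norm_num)) q2.1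
    have b5 := z 5 (ht 5 (by norm_num)) q2.2
    obtain ⟨i, hi, hbi⟩ := hb
    interval_cases i <;> exact hbi (by assumption)

/-! ### No common zero on the cycle: strict inequality -/

section

variable {V : Type*} [Fintype V] [DecidableEq V] {G : SimpleGraph V} [DecidableRel G.Adj]
  {g : ℕ} {c : ℕ → V} {d : V → ℕ} {par : V → V}

/-- Each off-cycle vertex has at most one cycle neighbour, so the sets being counted are disjoint.
-/
theorem IsCycleEnum.card_boundary (hc : IsCycleEnum G g c) :
    ∑ i ∈ Finset.range g, (2 * (offCycleNbrs G g c (c (i + 1))).card +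
      (offCycleNbrs G g c (c (i + 1)) ∩ innerVertices G).card) ≤
    2 * (cycleBoundary G g c).card + (cycleBoundary G g c ∩ innerVertices G).card := by
  obtain ⟨d, par, hr⟩ := hc.exists_rooting
  have hdisj : ∀ i ∈ Finset.range g, ∀ j ∈ Finset.range g, i ≠ j →
      Disjoint (offCycleNbrs G g c (c (i + 1))) (offCycleNbrs G g c (c (j + 1))) := by
    intro i hi j hj hij
    rw [Finset.disjoint_left]
    intro y hyi hyj
    simp only [offCycleNbrs, Finset.mem_sdiff, SimpleGraph.mem_neighborFinset] at hyi hyj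
    have h1 := hr.par_eq hc hyi.2 (hc.apply_mem _) hyi.1.symm
    have h2 := hr.par_eq hc hyj.2 (hc.apply_mem _) hyj.1.symm
    exact hij (hc.inj i (by simpa using hi) j (by simpa using hj)
      ((hc.succ_eq_iff i j).1 (h1.symm.trans h2)))
  rw [Finset.sum_add_distrib, ← Finset.mul_sum, ← Finset.card_biUnion hdisj,
    ← Finset.card_biUnion fun i hi j hj hij => (hdisj i hi j hj hij).mono
      Finset.inter_subset_left Finset.inter_subset_left]
  refine Nat.add_le_add (Nat.mul_le_mul_left _ (Finset.card_le_card ?_)) (Finset.card_le_card ?_)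
  · intro y hy
    obtain ⟨i, -, hi⟩ := Finset.mem_biUnion.1 hy
    exact hc.mem_cycleBoundary hi
  · intro y hy
    obtain ⟨i, -, hi⟩ := Finset.mem_biUnion.1 hy
    rw [Finset.mem_inter] at hi ⊢
    exact ⟨hc.mem_cycleBoundary hi.1, hi.2⟩

theorem IsCycleEnum.boundary_nonempty (hc : IsCycleEnum G g c) (hG : G.Connected)
    (hp : (pendantVertices G).Nonempty) : (cycleBoundary G g c).Nonempty := by
  by_contra h
  rw [Finset.not_nonempty_iff_eq_empty] at h
  obtain ⟨r, hr⟩ := hp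
  refine hc.not_pendant ?_ hr
  refine mem_of_adj_closed hG (cycleVertices g c) (a := c 0) (by simpa using hc.apply_mem 0) ?_ r
  intro u hu v huv
  by_contra hv
  have : v ∈ cycleBoundary G g c := by
    simp only [cycleBoundary, Finset.mem_filter, Finset.mem_univ, true_and]
    exact ⟨by simpa using hv, u, by simpa using hu, huv.symm⟩
  rw [h] at this
  simp at this

/-- Eigenvectors vanishing on the cycle and its boundary are determined by few coordinates. -/
theorem IsCycleEnum.finrank_add_boundary_le (hc : IsCycleEnum G g c)
    {K : Submodule ℝ (V → ℝ)} (hK : K ≤ lapOneSpace G)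
    (hC : ∀ x ∈ K, ∀ v ∈ cycleVertices g c, x v = 0)
    (hN : ∀ x ∈ K, ∀ v ∈ cycleBoundary G g c, x v = 0) :
    Module.finrank ℝ K + (cycleBoundary G g c).card ≤ (pendantVertices G).card := by
  classical
  obtain ⟨d, par, hr⟩ := hc.exists_rooting
  have hmemN : ∀ v, v ∈ cycleBoundary G g c ↔
      v ∉ cycleVertices g c ∧ ∃ w ∈ cycleVertices g c, G.Adj v w := by
    simp [cycleBoundary]
  have hroot : ∀ v, v ∉ cycleVertices g c → v ≠ c 0 := fun v hv h => hv (h ▸ hc.apply_mem 0)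
  have hadj : ∀ u v, G.Adj u v → u ∉ cycleVertices g c → par u = v ∨ (v ≠ c 0 ∧ par v = u) := by
    intro u v huv hu
    rcases hr.of_adj u v huv with h | h | h
    · exact Or.inl h.2
    · exact Or.inr h
    · rcases Sym2.eq_iff.1 h with ⟨rfl, -⟩ | ⟨rfl, -⟩ <;> exact absurd (hc.apply_mem _) hu
  have hchild : ∀ u, u ∉ cycleVertices g c → u ∉ pendantVertices G →
      ∃ z, z ≠ c 0 ∧ par z = u := by
    intro u hu hup
    by_contra hno
    push Not at hno
    apply hup
    rw [mem_pendantVertices, SimpleGraph.degree_eq_one_iff_existsUnique_adj]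
    refine ⟨par u, hr.adj u (hroot u hu), fun y hy => ?_⟩
    rcases hadj u y hy hu with h | h
    · exact h.symm
    · exact absurd h.2 (hno y h.1)
  choose! ch hch using hchild
  -- Each non-pendant off-cycle vertex chooses one child, which lies in `A`. The coordinates in `A`
  -- that are not chosen number `|P| - |N|`, where `P` is the set of pendant vertices and `N` the
  -- cycle boundary.
  let A : Finset V := Finset.univ \ (cycleVertices g c ∪ cycleBoundary G g c)
  let B : Finset V := Finset.univ \ (cycleVertices g c ∪ pendantVertices G)
  have hA : ∀ v, v ∈ A ↔ v ∉ cycleVertices g c ∧ v ∉ cycleBoundary G g c := by simp [A]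
  have hB : ∀ v, v ∈ B ↔ v ∉ cycleVertices g c ∧ v ∉ pendantVertices G := by simp [B]
  have hchA : B.image ch ⊆ A := by
    intro z hz
    obtain ⟨u, hu, rfl⟩ := Finset.mem_image.1 hz
    have hu' := (hB u).1 hu
    have h1 := hch u hu'.1 hu'.2
    have h2 : ch u ∉ cycleVertices g c := fun h => hu'.1 (h1.2 ▸ hr.par_mem hc h)
    refine (hA _).2 ⟨h2, fun h3 => ?_⟩
    obtain ⟨-, w, hw, hzw⟩ := (hmemN _).1 h3
    have := hr.par_eq hc h2 hw hzw
    rw [h1.2] at this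
    exact hu'.1 (this ▸ hw)
  have hcardB : (B.image ch).card = B.card := by
    refine Finset.card_image_of_injOn fun u hu v hv huv => ?_
    have hu' := (hB u).1 hu
    have hv' := (hB v).1 hv
    rw [← (hch u hu'.1 hu'.2).2, ← (hch v hv'.1 hv'.2).2, huv]
  have hcA : A.card + (g + (cycleBoundary G g c).card) = Fintype.card V := by
    have hd : Disjoint (cycleVertices g c) (cycleBoundary G g c) := by
      rw [Finset.disjoint_right]
      exact fun v hv => ((hmemN v).1 hv).1
    have h1 := Finset.card_union_of_disjoint hd
    rw [hc.card_cycleVertices] at h1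
    rw [← h1]
    have := Finset.card_le_univ (cycleVertices g c ∪ cycleBoundary G g c)
    simp only [A, Finset.card_univ_sdiff]
    omega
  have hcB : B.card + (g + (pendantVertices G).card) = Fintype.card V := by
    have hd : Disjoint (cycleVertices g c) (pendantVertices G) := by
      rw [Finset.disjoint_left]
      exact fun v hv => hc.not_pendant hv
    have h1 := Finset.card_union_of_disjoint hd
    rw [hc.card_cycleVertices] at h1
    rw [← h1]
    have := Finset.card_le_univ (cycleVertices g c ∪ pendantVertices G)
    simp only [B, Finset.card_univ_sdiff]
    omega
  have hS := Finset.card_sdiff_of_subset hchA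
  have hle := Finset.card_le_card hchA
  have hfin : Module.finrank ℝ K ≤ (A \ B.image ch).card := by
    refine finrank_le_card_of_restrict K _ fun x hx hx0 => ?_
    by_contra hne
    have hne' : ((Finset.univ : Finset V).filter fun v => x v ≠ 0).Nonempty := by
      obtain ⟨v, hv⟩ := Function.ne_iff.1 hne
      exact ⟨v, by simpa using hv⟩
    -- A nonzero vertex of least depth must be the chosen child of its parent. In the parent's
    -- equation the parent, the grandparent and all siblings vanish, the siblings being on the
    -- boundary or not chosen.
    obtain ⟨v, hv, hmin⟩ := Finset.exists_min_image _ d hne'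
    simp only [Finset.mem_filter, Finset.mem_univ, true_and] at hv hmin
    have hvC : v ∉ cycleVertices g c := fun h => hv (hC x hx v h)
    have hvN : v ∉ cycleBoundary G g c := fun h => hv (hN x hx v h)
    have hvr := hroot v hvC
    have hvu := hr.adj v hvr
    have huC : par v ∉ cycleVertices g c := fun h => hvN ((hmemN v).2 ⟨hvC, _, h, hvu⟩)
    have hdv := hr.depth v hvr
    have hdu := hr.depth _ (hroot _ huC)
    have hzero : ∀ z, d z < d v → x z = 0 := by
      intro z hz
      by_contra h
      have := hmin z h
      omega
    have hvimg : v ∈ B.image ch := by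
      by_contra h
      exact hv (hx0 v (Finset.mem_sdiff.2 ⟨(hA v).2 ⟨hvC, hvN⟩, h⟩))
    obtain ⟨u, hu, huv⟩ := Finset.mem_image.1 hvimg
    have hu' := (hB u).1 hu
    have hpu : par v = u := by rw [← huv]; exact (hch u hu'.1 hu'.2).2
    have he := mem_lapOneSpace.1 (hK hx) (par v)
    rw [hzero (par v) (by omega), mul_zero, Finset.sum_eq_single v] at he
    · exact hv he
    · intro z hz hzv
      rw [SimpleGraph.mem_neighborFinset] at hz
      rcases hadj _ _ hz huC with h | h
      · exact hzero z (by rw [← h]; omega)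
      by_cases hzC : z ∈ cycleVertices g c
      · exact hC x hx z hzC
      by_cases hzN : z ∈ cycleBoundary G g c
      · exact hN x hx z hzN
      refine hx0 z (Finset.mem_sdiff.2 ⟨(hA z).2 ⟨hzC, hzN⟩, fun himg => ?_⟩)
      obtain ⟨u', hu1, hu2⟩ := Finset.mem_image.1 himg
      have hu3 := (hB u').1 hu1
      have h4 : par z = u' := by rw [← hu2]; exact (hch u' hu3.1 hu3.2).2
      apply hzv
      rw [← hu2, ← huv]
      congr 1
      rw [← h4, h.2, hpu]
    · intro hnm
      exact absurd ((SimpleGraph.mem_neighborFinset _ _ _).2 hvu.symm) hnm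
  omega

/-- If no cycle vertex is a common zero of the eigenvectors, then the multiplicity is less than
a quarter of the order. -/
theorem IsCycleEnum.four_mul_finrank_lt (hc : IsCycleEnum G g c) (hG : G.Connected)
    (hn : 3 ≤ Fintype.card V) (hred : IsReducedGraph G) (hp : (pendantVertices G).Nonempty)
    (hB : ∀ i, ∃ z ∈ lapOneSpace G, z (c i) ≠ 0) :
    4 * Module.finrank ℝ (lapOneSpace G) < Fintype.card V := by
  have h3 := hc.three_le
  choose δ hδ hδ1 using fun i => hc.exists_recurrence (hB (i + 1))
  let f : lapOneSpace G →ₗ[ℝ] ℝ × ℝ :=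
    ((LinearMap.proj (c 0) : (V → ℝ) →ₗ[ℝ] ℝ).prod (LinearMap.proj (c 1))).comp
      (lapOneSpace G).subtype
  have hf : ∀ x (hx : x ∈ lapOneSpace G), f ⟨x, hx⟩ = (x (c 0), x (c 1)) := fun x hx => rfl
  -- The recurrence propagates two consecutive zeros around the whole cycle, and the Wronskian
  -- identity carries them to its boundary.
  let K : Submodule ℝ (V → ℝ) := (LinearMap.ker f).map (lapOneSpace G).subtype
  have hKmem : ∀ x ∈ K, x ∈ lapOneSpace G ∧ x (c 0) = 0 ∧ x (c 1) = 0 := by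
    rintro x ⟨⟨x', hx'⟩, hk, rfl⟩
    refine ⟨hx', ?_⟩
    rw [SetLike.mem_coe, LinearMap.mem_ker, hf] at hk
    exact Prod.mk_eq_zero.1 hk
  have hrank := f.finrank_range_add_finrank_ker
  have hKr : Module.finrank ℝ K = Module.finrank ℝ (LinearMap.ker f) :=
    Submodule.finrank_map_subtype_eq _ _
  have hKle : K ≤ lapOneSpace G := fun x hx => (hKmem x hx).1
  have hKC : ∀ x ∈ K, ∀ v ∈ cycleVertices g c, x v = 0 := by
    intro x hx v hv
    obtain ⟨h1, h2, h3⟩ := hKmem x hx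
    obtain ⟨i, rfl⟩ := hc.mem_cycleVertices.1 hv
    have : ∀ i, x (c i) = 0 ∧ x (c (i + 1)) = 0 := by
      intro i
      induction i with
      | zero => exact ⟨h2, h3⟩
      | succ i ih =>
        refine ⟨ih.2, ?_⟩
        have := hδ i x h1
        rw [ih.1, ih.2, mul_zero, zero_add] at this
        exact this
    exact (this i).1
  have hKN : ∀ x ∈ K, ∀ v ∈ cycleBoundary G g c, x v = 0 := by
    intro x hx y hy
    simp only [cycleBoundary, Finset.mem_filter, Finset.mem_univ, true_and] at hy
    obtain ⟨hyC, w, hw, hyw⟩ := hy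
    obtain ⟨i, rfl⟩ := hc.mem_cycleVertices.1 hw
    obtain ⟨z, hz, hz0⟩ := hB i
    have := hc.wronskian hyC hw hyw (hKle hx) hz
    rw [hKC x hx _ hw, mul_zero] at this
    exact (mul_eq_zero.1 this).resolve_right hz0
  have hK1 := hc.finrank_add_boundary_le hKle hKC hKN
  have hCR : cycleVertices g c ⊆ innerVertices G := by
    intro v hv
    refine mem_innerVertices.2 ⟨hc.not_pendant hv, fun hq => ?_⟩
    obtain ⟨i, rfl⟩ := hc.mem_cycleVertices.1 hv
    obtain ⟨z, hz, hz0⟩ := hB i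
    exact hz0 (eq_zero_of_quasiPendant hz hq)
  have hdisj : Disjoint (cycleVertices g c) (cycleBoundary G g c ∩ innerVertices G) := by
    rw [Finset.disjoint_right]
    intro v hv
    simp only [cycleBoundary, Finset.mem_inter, Finset.mem_filter] at hv
    exact hv.1.2.1
  obtain ⟨col, hcol⟩ := hc.exists_coloring
  have hK2 := two_mul_finrank_le (Z := cycleVertices g c ∪ cycleBoundary G g c ∩ innerVertices G)
    hG hn hred (col := col)
    (fun u v huv hu hv => hcol u v huv
      (fun h => hu (Finset.mem_union_left _ (h ▸ hc.apply_mem 0)))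
      (fun h => hv (Finset.mem_union_left _ (h ▸ hc.apply_mem 0)))) hKle (by
    intro x hx z hz
    rcases Finset.mem_union.1 hz with h | h
    · exact hKC x hx z h
    · exact hKN x hx z (Finset.mem_inter.1 h).1)
  have hsub : cycleVertices g c ∪ cycleBoundary G g c ∩ innerVertices G ⊆ innerVertices G :=
    Finset.union_subset hCR Finset.inter_subset_right
  rw [Finset.card_sdiff_of_subset hsub, Finset.card_union_of_disjoint hdisj,
    hc.card_cycleVertices] at hK2
  have hle := Finset.card_le_card hsub
  rw [Finset.card_union_of_disjoint hdisj, hc.card_cycleVertices] at hle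
  have hcard := card_inner hG hn
  have hpq : (pendantVertices G).card = (quasiPendantVertices G).card := hred
  have hNpos := (hc.boundary_nonempty hG hp).card_pos
  have hr2 : Module.finrank ℝ (LinearMap.range f) ≤ 2 := by
    have := Submodule.finrank_le (LinearMap.range f)
    simpa using this
  -- The bounds on `K` leave a slack of `g + 2|N| + |N ∩ R|`, with `N` the boundary and `R` the
  -- inner vertices. Rank at most 1 contributes at most 4, below the slack since `g ≥ 3` and `|N| ≥
  -- 1`; rank 2 contributes 8, so a slack of 9 is needed.
  by_cases hr1 : Module.finrank ℝ (LinearMap.range f) ≤ 1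
  · omega
  · have htop : LinearMap.range f = ⊤ := by
      apply Submodule.eq_top_of_finrank_eq
      simp only [Module.finrank_prod, Module.finrank_self]
      omega
    rw [LinearMap.range_eq_top] at htop
    obtain ⟨⟨X, hX⟩, hX01⟩ := htop (1, 0)
    obtain ⟨⟨Z, hZ⟩, hZ01⟩ := htop (0, 1)
    rw [hf, Prod.mk.injEq] at hX01 hZ01
    have hbne : ∃ i < g, (offCycleNbrs G g c (c (i + 1))).card ≠ 0 := by
      obtain ⟨y, hy⟩ := hc.boundary_nonempty hG hp
      simp only [cycleBoundary, Finset.mem_filter, Finset.mem_univ, true_and] at hy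
      obtain ⟨hyC, w, hw, hyw⟩ := hy
      obtain ⟨i, rfl⟩ := hc.exists_succ hw
      refine ⟨i % g, Nat.mod_lt _ (by omega), ?_⟩
      rw [(hc.succ_eq_iff (i % g) i).2 (hc.mod i)]
      refine Finset.card_ne_zero_of_mem (a := y) ?_
      simp only [offCycleNbrs, Finset.mem_sdiff, SimpleGraph.mem_neighborFinset]
      exact ⟨hyw.symm, hyC⟩
    have h9 := nine_le_of_recurrence h3 (δ := δ)
      (b := fun i => (offCycleNbrs G g c (c (i + 1))).card)
      (t := fun i => (offCycleNbrs G g c (c (i + 1)) ∩ innerVertices G).card)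
      (X := fun i => X (c i)) (Z := fun i => Z (c i))
      (fun i => Finset.card_le_card Finset.inter_subset_left) hδ1
      (fun i => by simp only [hc.periodic]) (fun i => by simp only [hc.periodic])
      (fun i => hδ i X hX) (fun i => hδ i Z hZ) hX01.1 hX01.2 hZ01.1 hZ01.2 hbne
    have := hc.card_boundary (G := G)
    omega

end

/-! ### Equality: local structure -/

section

variable {V : Type*} [Fintype V] [DecidableEq V] {G : SimpleGraph V} [DecidableRel G.Adj]
  {g : ℕ} {c : ℕ → V}

/-- If every function on a colour class of the inner vertices extends to an eigenvector, then the
inner vertices induce a perfect matching and have degree two. -/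
theorem inner_structure_of_extend (hG : G.Connected) (hn : 3 ≤ Fintype.card V) {col : V → Fin 2}
    (hcol : ∀ u ∈ innerVertices G, ∀ v ∈ innerVertices G, G.Adj u v → col u ≠ col v)
    (hext : ∀ a ∈ innerVertices G, ∃ x ∈ lapOneSpace G, x a = 1 ∧
      ∀ a' ∈ innerVertices G, col a' = col a → a' ≠ a → x a' = 0) :
    ∀ v ∈ innerVertices G, G.degree v = 2 ∧
      ∃ b ∈ innerVertices G, G.Adj v b ∧ ∀ b' ∈ innerVertices G, G.Adj v b' → b' = b := by
  -- The `ξ a` behave like a dual basis on a colour class. At an inner `b` of the other colour,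
  -- `(deg b - 1) * ξ a b` is 1 if `b` is adjacent to `a` and 0 otherwise.
  choose! ξ hξ hξ1 hξ0 using hext
  have hdeg : ∀ v ∈ innerVertices G, (1 : ℝ) ≤ G.degree v - 1 := by
    intro v hv
    have h := two_le_degree hG hn (mem_innerVertices.1 hv).1
    have h' : (2 : ℝ) ≤ G.degree v := by exact_mod_cast h
    linarith
  have hzero : ∀ v ∈ innerVertices G, ∀ x ∈ lapOneSpace G, ∀ u, G.Adj v u →
      u ∉ innerVertices G → x u = 0 := by
    intro v hv x hx u huv hu
    rw [mem_innerVertices, not_and_or, not_not, not_not] at hu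
    rcases hu with hu | hu
    · exact absurd (mem_quasiPendant_of_adj hu huv.symm) (mem_innerVertices.1 hv).2
    · exact eq_zero_of_quasiPendant hx hu
  have hval : ∀ a ∈ innerVertices G, ∀ b ∈ innerVertices G, G.Adj a b →
      0 < ξ a b ∧ ((G.degree b : ℝ) - 1) * ξ a b = 1 := by
    intro a ha b hb hab
    have h1 := mem_lapOneSpace.1 (hξ a ha) b
    rw [Finset.sum_eq_single_of_mem a (by simpa using hab.symm), hξ1 a ha] at h1
    · have h2 := hdeg b hb
      refine ⟨?_, h1.symm⟩
      by_contra h3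
      push Not at h3
      nlinarith
    · intro u hu hua
      rw [SimpleGraph.mem_neighborFinset] at hu
      by_cases huR : u ∈ innerVertices G
      · refine hξ0 a ha u huR ?_ hua
        have h2 := hcol a ha b hb hab
        have h3 := hcol b hb u huR hu
        omega
      · exact hzero b hb _ (hξ a ha) u hu huR
  have hval0 : ∀ a ∈ innerVertices G, ∀ b ∈ innerVertices G, ¬ G.Adj a b → col b ≠ col a →
      ξ a b = 0 := by
    intro a ha b hb hab hne
    have h1 := mem_lapOneSpace.1 (hξ a ha) b
    rw [Finset.sum_eq_zero] at h1
    · have h2 := hdeg b hb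
      rcases mul_eq_zero.1 h1.symm with h | h
      · linarith
      · exact h
    · intro u hu
      rw [SimpleGraph.mem_neighborFinset] at hu
      by_cases huR : u ∈ innerVertices G
      · refine hξ0 a ha u huR ?_ ?_
        · have h3 := hcol b hb u huR hu
          omega
        · rintro rfl; exact hab hu.symm
      · exact hzero b hb _ (hξ a ha) u hu huR
  have hnonneg : ∀ a ∈ innerVertices G, ∀ b ∈ innerVertices G, col b ≠ col a → 0 ≤ ξ a b := by
    intro a ha b hb hne
    by_cases hab : G.Adj a b
    · exact (hval a ha b hb hab).1.le
    · exact (hval0 a ha b hb hab hne).ge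
  -- If `b` had inner neighbours `a ≠ a'`, the equation for `ξ a` at `a'` would be a vanishing sum
  -- of nonnegative terms containing `ξ a b > 0`.
  have huniq : ∀ b ∈ innerVertices G, ∀ a ∈ innerVertices G, ∀ a' ∈ innerVertices G,
      G.Adj b a → G.Adj b a' → a' = a := by
    intro b hb a ha a' ha' hba hba'
    by_contra hne
    have hc1 := hcol b hb a ha hba
    have hc2 := hcol b hb a' ha' hba'
    have h1 := mem_lapOneSpace.1 (hξ a ha) a'
    rw [hξ0 a ha a' ha' (by omega) hne, mul_zero] at h1
    have h2 : ∀ u ∈ G.neighborFinset a', 0 ≤ ξ a u := by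
      intro u hu
      rw [SimpleGraph.mem_neighborFinset] at hu
      by_cases huR : u ∈ innerVertices G
      · have h3 := hcol a' ha' u huR hu
        exact hnonneg a ha u huR (by omega)
      · exact (hzero a' ha' _ (hξ a ha) u hu huR).ge
    have h3 := (Finset.sum_eq_zero_iff_of_nonneg h2).1 h1 b (by simpa using hba'.symm)
    have h4 := (hval a ha b hb hba.symm).1
    linarith
  intro v hv
  have h1 := mem_lapOneSpace.1 (hξ v hv) v
  rw [hξ1 v hv, mul_one] at h1
  have hex : ∃ b ∈ innerVertices G, G.Adj v b := by
    by_contra hno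
    push Not at hno
    rw [Finset.sum_eq_zero] at h1
    · have := hdeg v hv
      linarith
    · intro u hu
      rw [SimpleGraph.mem_neighborFinset] at hu
      exact hzero v hv _ (hξ v hv) u hu fun h => hno u h hu
  obtain ⟨b, hb, hvb⟩ := hex
  refine ⟨?_, b, hb, hvb, fun b' hb' h => huniq v hv b hb b' hb' hvb h⟩
  -- Now `deg v - 1 = ξ v b = 1 / (deg b - 1)`, and both degrees are at least 2.
  rw [Finset.sum_eq_single_of_mem b (by simpa using hvb)] at h1
  · have h2 := (hval v hv b hb hvb).2
    rw [h1] at h2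
    have h3 := hdeg v hv
    have h4 := hdeg b hb
    have h5 : (G.degree v : ℝ) - 1 ≤ 1 := by nlinarith
    have h6 : (G.degree v : ℝ) = 2 := by linarith
    exact_mod_cast h6
  · intro u hu hub
    rw [SimpleGraph.mem_neighborFinset] at hu
    exact hzero v hv _ (hξ v hv) u hu fun h => hub (huniq v hv b hb u h hvb hu)

theorem degree_eq_add (hG : G.Connected) (hn : 3 ≤ Fintype.card V) (v : V) :
    G.degree v = ((pendantVertices G).filter (G.Adj v)).card +
      ((quasiPendantVertices G).filter (G.Adj v)).card +
      ((innerVertices G).filter (G.Adj v)).card := by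
  rw [← Finset.card_union_of_disjoint, ← Finset.card_union_of_disjoint,
    ← SimpleGraph.card_neighborFinset_eq_degree]
  · congr 1
    ext u
    simp only [SimpleGraph.mem_neighborFinset, Finset.mem_union, Finset.mem_filter,
      mem_innerVertices]
    tauto
  · rw [Finset.disjoint_left]
    intro u hu hu'
    simp only [Finset.mem_union, Finset.mem_filter, mem_innerVertices] at hu hu'
    tauto
  · rw [Finset.disjoint_left]
    intro u hu hu'
    simp only [Finset.mem_filter] at hu hu'
    exact not_mem_pendant_of_mem_quasiPendant hG hn hu'.1 hu.1

/-- Deleting one cycle edge leaves a spanning tree, so there are as many edges as vertices. -/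
theorem IsCycleEnum.sum_degrees (hc : IsCycleEnum G g c) :
    ∑ v, G.degree v = 2 * Fintype.card V := by
  classical
  rw [G.sum_degrees_eq_twice_card_edges]
  have h1 := (hc.isTree 0).card_edgeFinset
  have h2 : (G.deleteEdges {s(c 0, c (0 + 1))}).edgeFinset =
      G.edgeFinset \ {s(c 0, c (0 + 1))} := by
    ext e
    simp [SimpleGraph.edgeSet_deleteEdges]
  rw [h2, Finset.card_sdiff_of_subset (by simpa using hc.adj 0), Finset.card_singleton] at h1
  have h3 : 0 < G.edgeFinset.card :=
    Finset.card_pos.2 ⟨s(c 0, c (0 + 1)), by simpa using hc.adj 0⟩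
  omega

/-- A quasi-pendant vertex of degree two with an inner neighbour of degree two lies on a pendant
path `P₃`. -/
theorem hasPendantPath_three {u q z z' : V} (hu : G.degree u = 1) (hq : G.degree q = 2)
    (hz : G.degree z = 2) (hqu : G.Adj q u) (hqz : G.Adj q z) (hzz : G.Adj z z')
    (hzu : z ≠ u) (hz'u : z' ≠ u) (hz'q : z' ≠ q) : HasPendantPath G 3 := by
  have nu : ∀ v, G.Adj u v ↔ v = q := by
    intro v
    rw [SimpleGraph.degree_eq_one_iff_existsUnique_adj] at hu
    exact ⟨fun h => hu.unique h hqu.symm, fun h => h ▸ hqu.symm⟩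
  have two : ∀ a b e : V, G.degree a = 2 → G.Adj a b → G.Adj a e → b ≠ e →
      ∀ v, G.Adj a v ↔ v = b ∨ v = e := by
    intro a b e ha hb he hbe v
    have hs : ({b, e} : Finset V) = G.neighborFinset a := by
      refine Finset.eq_of_subset_of_card_le ?_ ?_
      · intro y hy
        rw [SimpleGraph.mem_neighborFinset]
        rcases Finset.mem_insert.1 hy with rfl | hy
        · exact hb
        · rw [Finset.mem_singleton.1 hy]; exact he
      · rw [SimpleGraph.card_neighborFinset_eq_degree, ha, Finset.card_pair hbe]
    rw [← SimpleGraph.mem_neighborFinset, ← hs]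
    simp
  have nq := two q u z hq hqu hqz hzu.symm
  have nz := two z q z' hz hqz.symm hzz hz'q.symm
  have hinj : Function.Injective ![z, q, u] := by
    intro i j h
    fin_cases i <;> fin_cases j <;> simp at h ⊢
    · exact hqz.ne h.symm
    · exact hzu h
    · exact hqz.ne h
    · exact hqu.ne h
    · exact hzu h.symm
    · exact hqu.ne h.symm
  have hrange : ∀ v, v ∉ Set.range ![z, q, u] ↔ v ≠ z ∧ v ≠ q ∧ v ≠ u := by
    intro v
    simp only [Matrix.range_cons, Matrix.range_empty, Set.mem_union, Set.mem_singleton_iff,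
      Set.mem_empty_iff_false]
    tauto
  refine ⟨⟨⟨![z, q, u], hinj⟩, ?_⟩, z', ?_, ?_⟩
  · intro i j
    rw [SimpleGraph.pathGraph_adj]
    fin_cases i <;> fin_cases j <;> simp [nu, nq, nz, hqz.ne', hqu.ne', hzu, hzu.symm,
      hz'u.symm]
  · exact (hrange z').2 ⟨hzz.ne', hz'q, hz'u⟩
  · intro i v hv
    obtain ⟨h1, h2, h3⟩ := (hrange v).1 hv
    fin_cases i <;> simp [nu, nq, nz, h1, h2, h3]

/-- The structure of a reduced unicyclic graph in the extremal case, at quasi-pendant vertices. -/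
theorem IsCycleEnum.quasiPendant_structure (hc : IsCycleEnum G g c) (hG : G.Connected)
    (hn : 3 ≤ Fintype.card V) (hred : IsReducedGraph G) (hP3 : ¬ HasPendantPath G 3)
    (hR : ∀ v ∈ innerVertices G, G.degree v = 2 ∧
      ∃ b ∈ innerVertices G, G.Adj v b ∧ ∀ b' ∈ innerVertices G, G.Adj v b' → b' = b)
    (hcard : (innerVertices G).card = 2 * (pendantVertices G).card) :
    ∀ q ∈ quasiPendantVertices G, G.degree q = 3 ∧
      ∀ q' ∈ quasiPendantVertices G, ¬ G.Adj q q' := by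
  have hpq : (pendantVertices G).card = (quasiPendantVertices G).card := hred
  have hRP : ∀ v ∈ innerVertices G, ((pendantVertices G).filter (G.Adj v)).card = 0 := by
    intro v hv
    rw [Finset.card_eq_zero, Finset.filter_eq_empty_iff]
    exact fun u hu h => (mem_innerVertices.1 hv).2 (mem_quasiPendant_of_adj hu h.symm)
  have hRR : ∀ v ∈ innerVertices G, ((innerVertices G).filter (G.Adj v)).card = 1 := by
    intro v hv
    obtain ⟨-, b, hb, hvb, hu⟩ := hR v hv
    rw [Finset.card_eq_one]
    refine ⟨b, ?_⟩
    ext b'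
    simp only [Finset.mem_filter, Finset.mem_singleton]
    exact ⟨fun h => hu b' h.1 h.2, fun h => h ▸ ⟨hb, hvb⟩⟩
  have hRQ : ∀ v ∈ innerVertices G, ((quasiPendantVertices G).filter (G.Adj v)).card = 1 := by
    intro v hv
    have h := degree_eq_add hG hn v
    rw [hRP v hv, hRR v hv, (hR v hv).1] at h
    omega
  have hQP : ∀ q ∈ quasiPendantVertices G, ((pendantVertices G).filter (G.Adj q)).card = 1 := by
    intro q hq
    obtain ⟨u, hu, huq⟩ := mem_quasiPendantVertices.1 hq
    rw [Finset.card_eq_one]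
    refine ⟨u, ?_⟩
    ext u'
    simp only [Finset.mem_filter, Finset.mem_singleton]
    exact ⟨fun h => hred.pendant_unique h.1 hu h.2.symm huq, fun h => h ▸ ⟨hu, huq.symm⟩⟩
  have hdc : ∑ q ∈ quasiPendantVertices G, ((innerVertices G).filter (G.Adj q)).card =
      (innerVertices G).card := by
    have h1 := Finset.sum_card_bipartiteAbove_eq_sum_card_bipartiteBelow
      (s := innerVertices G) (t := quasiPendantVertices G) G.Adj
    have h2 : ∑ v ∈ innerVertices G, (Finset.bipartiteAbove G.Adj (quasiPendantVertices G) v).card =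
        (innerVertices G).card := by
      exact (Finset.sum_congr (g := fun _ => 1) rfl fun v hv => hRQ v hv).trans (by simp)
    rw [← h2, h1]
    refine Finset.sum_congr rfl fun q _ => ?_
    congr 1
    exact Finset.filter_congr fun v _ => G.adj_comm q v
  -- With `p` pendant vertices, the degree sum is `8p`; pendant vertices account for `p` and inner
  -- ones for `4p`.
  have hdQ : ∑ q ∈ quasiPendantVertices G, G.degree q = 3 * (pendantVertices G).card := by
    have hsum := hc.sum_degrees (G := G)
    have hd : Disjoint (pendantVertices G) (quasiPendantVertices G) := by
      rw [Finset.disjoint_right]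
      exact fun v hv => not_mem_pendant_of_mem_quasiPendant hG hn hv
    have hs := Finset.sum_sdiff (f := fun v => G.degree v)
      (Finset.subset_univ (pendantVertices G ∪ quasiPendantVertices G))
    rw [Finset.sum_union hd, hsum] at hs
    have h1 : ∑ v ∈ pendantVertices G, G.degree v = (pendantVertices G).card := by
      rw [Finset.sum_congr rfl (g := fun _ => 1) fun v hv => mem_pendantVertices.1 hv]
      simp
    have h2 : ∑ v ∈ Finset.univ \ (pendantVertices G ∪ quasiPendantVertices G), G.degree v =
        (innerVertices G).card * 2 := by
      exact (Finset.sum_congr (s₂ := innerVertices G) (g := fun _ => 2) rfl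
        fun v hv => (hR v hv).1).trans (by simp)
    have h3 := card_inner hG hn
    rw [h1, h2] at hs
    omega
  have hsplit : ∑ q ∈ quasiPendantVertices G, G.degree q =
      (pendantVertices G).card + ∑ q ∈ quasiPendantVertices G,
        ((quasiPendantVertices G).filter (G.Adj q)).card + (innerVertices G).card := by
    rw [Finset.sum_congr rfl (g := fun q => 1 + ((quasiPendantVertices G).filter (G.Adj q)).card +
      ((innerVertices G).filter (G.Adj q)).card) fun q hq => by
        rw [degree_eq_add hG hn q, hQP q hq]]
    rw [Finset.sum_add_distrib, Finset.sum_add_distrib, hdc, hpq]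
    simp
  -- Pendant and inner neighbours already account for the whole total `3p`.
  have hQQ : ∀ q ∈ quasiPendantVertices G,
      ((quasiPendantVertices G).filter (G.Adj q)).card = 0 := by
    have h0 : ∑ q ∈ quasiPendantVertices G,
        ((quasiPendantVertices G).filter (G.Adj q)).card = 0 := by omega
    exact fun q hq => (Finset.sum_eq_zero_iff.1 h0) q hq
  have hindep : ∀ q ∈ quasiPendantVertices G, ∀ q' ∈ quasiPendantVertices G, ¬ G.Adj q q' := by
    intro q hq q' hq' h
    have := hQQ q hq
    rw [Finset.card_eq_zero, Finset.filter_eq_empty_iff] at this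
    exact this hq' h
  -- Degree 2 would create a pendant P₃ made of an inner vertex, `q` and its pendant vertex. As the
  -- average degree is 3, every degree is then exactly 3.
  have hge : ∀ q ∈ quasiPendantVertices G, 3 ≤ G.degree q := by
    intro q hq
    have h2 := two_le_degree hG hn (not_mem_pendant_of_mem_quasiPendant hG hn hq)
    by_contra hlt
    have hdq : G.degree q = 2 := by omega
    have h := degree_eq_add hG hn q
    rw [hQP q hq, hQQ q hq, hdq] at h
    have h1 : 0 < ((innerVertices G).filter (G.Adj q)).card := by omega
    obtain ⟨z, hz⟩ := Finset.card_pos.1 h1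
    rw [Finset.mem_filter] at hz
    obtain ⟨u, hu, huq⟩ := mem_quasiPendantVertices.1 hq
    obtain ⟨hzd, b, hb, hzb, -⟩ := hR z hz.1
    have hzi := mem_innerVertices.1 hz.1
    have hbi := mem_innerVertices.1 hb
    exact hP3 (hasPendantPath_three (mem_pendantVertices.1 hu) hdq hzd huq.symm hz.2 hzb
      (fun e => hzi.1 (e ▸ hu)) (fun e => hbi.1 (e ▸ hu)) (fun e => hbi.2 (e ▸ hq)))
  have heq : ∑ q ∈ quasiPendantVertices G, 3 = ∑ q ∈ quasiPendantVertices G, G.degree q := by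
    rw [hdQ, hpq]
    simp [mul_comm]
  have h3 := (Finset.sum_eq_sum_iff_of_le hge).1 heq
  exact fun q hq => ⟨(h3 q hq).symm, hindep q hq⟩

end

/-! ### Equality: the isomorphism with the extremal graph -/

theorem fin_sub_val_eq_one_iff {n : ℕ} (hn : 2 ≤ n) (u v : Fin n) :
    (v - u).val = 1 ↔ v.val = (u.val + 1) % n := by
  have hu := u.isLt
  have hv := v.isLt
  rw [Fin.val_sub]
  rcases Nat.lt_or_ge (u.val + 1) n with h | h
  · rw [Nat.mod_eq_of_lt h]
    rcases Nat.lt_or_ge v.val u.val with h1 | h1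
    · rw [Nat.mod_eq_of_lt (by omega)]; omega
    · rw [show n - u.val + v.val = (v.val - u.val) + n by omega, Nat.add_mod_right,
        Nat.mod_eq_of_lt (by omega)]
      omega
  · rw [show u.val + 1 = n by omega, Nat.mod_self, show n - u.val + v.val = v.val + 1 by omega]
    rcases Nat.lt_or_ge (v.val + 1) n with h1 | h1
    · rw [Nat.mod_eq_of_lt h1]; omega
    · rw [show v.val + 1 = n by omega, Nat.mod_self]; omega

theorem cycleGraph_adj_iff {n : ℕ} (hn : 2 ≤ n) (u v : Fin n) :
    (SimpleGraph.cycleGraph n).Adj u v ↔ v.val = (u.val + 1) % n ∨ u.val = (v.val + 1) % n := by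
  rw [SimpleGraph.cycleGraph_adj', fin_sub_val_eq_one_iff hn, fin_sub_val_eq_one_iff hn, or_comm]

section

variable {V : Type*} [Fintype V] [DecidableEq V] {G : SimpleGraph V} [DecidableRel G.Adj]
  {g : ℕ} {c : ℕ → V}

/-- A reduced unicyclic graph with the local structure of the extremal graph is extremal. -/
theorem IsCycleEnum.nonempty_iso (hc : IsCycleEnum G g c) (hG : G.Connected)
    (hn : 3 ≤ Fintype.card V)
    (hR : ∀ v ∈ innerVertices G, G.degree v = 2 ∧
      ∃ b ∈ innerVertices G, G.Adj v b ∧ ∀ b' ∈ innerVertices G, G.Adj v b' → b' = b)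
    (hQ : ∀ q ∈ quasiPendantVertices G, G.degree q = 3 ∧
      ∀ q' ∈ quasiPendantVertices G, ¬ G.Adj q q')
    (hcard : Fintype.card V = 4 * (pendantVertices G).card) (h0 : c 0 ∈ quasiPendantVertices G) :
    Nonempty (G ≃g extremalGraph (pendantVertices G).card) := by
  have h3 := hc.three_le
  have hcyc : ∀ i, c i ∉ quasiPendantVertices G → c i ∈ innerVertices G := fun i h =>
    mem_innerVertices.2 ⟨hc.not_pendant (hc.apply_mem i), h⟩
  -- Two neighbours lie on the cycle; degree 3 leaves only the pendant neighbour, and degree 2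
  -- leaves none.
  have hoff : ∀ i, ∀ v ∈ offCycleNbrs G g c (c i), v ∈ pendantVertices G := by
    intro i v hv
    obtain ⟨j, hj⟩ := hc.exists_succ (hc.apply_mem i)
    rw [← hj] at hv
    have hd := hc.degree_eq (G := G) j
    by_cases hq : c (j + 1) ∈ quasiPendantVertices G
    · rw [(hQ _ hq).1] at hd
      obtain ⟨u, hu, hua⟩ := mem_quasiPendantVertices.1 hq
      have hu' : u ∈ offCycleNbrs G g c (c (j + 1)) := by
        simp only [offCycleNbrs, Finset.mem_sdiff, SimpleGraph.mem_neighborFinset]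
        exact ⟨hua.symm, fun h => hc.not_pendant h hu⟩
      have := Finset.card_le_one.1 (show (offCycleNbrs G g c (c (j + 1))).card ≤ 1 by omega) v hv u hu'
      exact this ▸ hu
    · rw [(hR _ (hcyc _ hq)).1] at hd
      have : offCycleNbrs G g c (c (j + 1)) = ∅ := Finset.card_eq_zero.1 (by omega)
      rw [this] at hv
      simp at hv
  have hall : ∀ v, v ∉ pendantVertices G → v ∈ cycleVertices g c := by
    intro v hv
    have := mem_of_adj_closed hG
      {v | v ∈ cycleVertices g c ∨ (v ∈ pendantVertices G ∧ ∃ w ∈ cycleVertices g c, G.Adj v w)}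
      (a := c 0) (Or.inl (hc.apply_mem 0)) (by
        rintro u (hu | ⟨hu, w, hw, huw⟩) v huv
        · by_cases hvC : v ∈ cycleVertices g c
          · exact Or.inl hvC
          · obtain ⟨i, rfl⟩ := hc.mem_cycleVertices.1 hu
            refine Or.inr ⟨hoff i v ?_, c i, hu, huv.symm⟩
            simp only [offCycleNbrs, Finset.mem_sdiff, SimpleGraph.mem_neighborFinset]
            exact ⟨huv, hvC⟩
        · exact Or.inl (eq_of_adj_pendant hu huw huv ▸ hw)) v
    exact this.resolve_right fun h => hv h.1
  have hg : g = 3 * (pendantVertices G).card := by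
    have : cycleVertices g c = (pendantVertices G)ᶜ := by
      ext v
      rw [Finset.mem_compl]
      exact ⟨hc.not_pendant, hall v⟩
    have h := hc.card_cycleVertices
    rw [this, Finset.card_compl] at h
    omega
  have hpat : ∀ k, c (3 * k) ∈ quasiPendantVertices G ∧ c (3 * k + 1) ∈ innerVertices G ∧
      c (3 * k + 2) ∈ innerVertices G ∧ c (3 * k + 3) ∈ quasiPendantVertices G := by
    -- Quasi-pendant vertices are independent and each inner vertex has exactly one inner neighbour,
    -- so along the cycle they are separated by exactly two inner vertices.
    have step : ∀ j, c j ∈ quasiPendantVertices G → c (j + 1) ∈ innerVertices G ∧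
        c (j + 2) ∈ innerVertices G ∧ c (j + 3) ∈ quasiPendantVertices G := by
      intro j hj
      have h1 : c (j + 1) ∈ innerVertices G := hcyc _ fun h => (hQ _ hj).2 _ h (hc.adj j)
      obtain ⟨hd, b, hb, hab, -⟩ := hR _ h1
      have h2 : c (j + 2) ∈ innerVertices G := by
        have hoff' : offCycleNbrs G g c (c (j + 1)) = ∅ := by
          have := hc.degree_eq (G := G) j
          exact Finset.card_eq_zero.1 (by omega)
        have hm : b ∈ G.neighborFinset (c (j + 1)) := by simpa using hab
        rw [hc.neighborFinset_eq, hoff'] at hm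
        rcases Finset.mem_insert.1 hm with h | h
        · exact absurd hj (mem_innerVertices.1 (h ▸ hb)).2
        · have : b = c (j + 2) := by simpa using h
          exact this ▸ hb
      refine ⟨h1, h2, ?_⟩
      by_contra h
      obtain ⟨-, b', -, -, hu⟩ := hR _ h2
      have e1 := hu _ h1 (hc.adj (j + 1)).symm
      have e2 := hu _ (hcyc _ h) (hc.adj (j + 2))
      exact hc.ne_add_two (j + 1) (e1.trans e2.symm)
    intro k
    induction k with
    | zero => exact ⟨h0, step 0 h0⟩
    | succ k ih => exact ⟨ih.2.2.2, step _ ih.2.2.2⟩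
  generalize ht : (pendantVertices G).card = t at *
  have hiff : ∀ i, c i ∈ quasiPendantVertices G → i % 3 = 0 := by
    intro i hi
    have := hpat (i / 3)
    by_contra hne
    rcases (by omega : i = 3 * (i / 3) + 1 ∨ i = 3 * (i / 3) + 2) with h | h
    · rw [h] at hi; exact (mem_innerVertices.1 this.2.1).2 hi
    · rw [h] at hi; exact (mem_innerVertices.1 this.2.2.1).2 hi
  choose pe hpe hpea using fun k => mem_quasiPendantVertices.1 (hpat k).1
  subst hg
  let F : Fin (3 * t) ⊕ Fin t → V := Sum.elim (fun i => c i) (fun s => pe s)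
  have hinj : Function.Injective F := by
    rintro (i | s) (j | r) h
    · exact congrArg _ (Fin.ext (hc.inj i i.isLt j j.isLt h))
    · exact absurd (h ▸ hpe r : F (Sum.inl i) ∈ pendantVertices G) (hc.not_pendant (hc.apply_mem _))
    · exact absurd (h ▸ hpe s : F (Sum.inl j) ∈ pendantVertices G) (hc.not_pendant (hc.apply_mem _))
    · have h' : pe s = pe r := h
      have h1 := hpea s
      rw [h'] at h1
      have h2 := hc.inj _ (by omega) _ (by omega) (eq_of_adj_pendant (hpe r) h1 (hpea r))
      exact congrArg _ (Fin.ext (by omega))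
  have hbij : Function.Bijective F := by
    rw [Fintype.bijective_iff_injective_and_card]
    refine ⟨hinj, ?_⟩
    simp only [Fintype.card_sum, Fintype.card_fin]
    omega
  have hcp : ∀ i k, i < 3 * t → k < t → (G.Adj (pe k) (c i) ↔ i = 3 * k) := by
    intro i k hi hk
    constructor
    · intro h
      exact hc.inj _ hi _ (by omega) (eq_of_adj_pendant (hpe k) h (hpea k))
    · rintro rfl; exact hpea k
  refine ⟨RelIso.symm ⟨Equiv.ofBijective F hbij, ?_⟩⟩
  rintro (i | s) (j | r)
  · change G.Adj (c i) (c j) ↔ (SimpleGraph.cycleGraph (3 * t)).Adj i j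
    have hmod : ∀ i j : Fin (3 * t), c j = c (i + 1) ↔ j.val = (i.val + 1) % (3 * t) := by
      intro i j
      rw [hc.eq_iff, Nat.mod_eq_of_lt j.isLt]
    rw [cycleGraph_adj_iff (by omega), ← hmod, ← hmod]
    constructor
    · exact hc.eq_of_adj
    · rintro (h | h)
      · rw [h]; exact hc.adj _
      · rw [h]; exact (hc.adj _).symm
  · change G.Adj (c i) (pe r) ↔ i.val = 3 * r.val
    rw [G.adj_comm, hcp _ _ i.isLt r.isLt]
  · change G.Adj (pe s) (c j) ↔ j.val = 3 * s.val
    rw [hcp _ _ j.isLt s.isLt]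
  · change G.Adj (pe s) (pe r) ↔ False
    rw [iff_false]
    intro h
    exact not_mem_pendant_of_mem_quasiPendant hG hn (mem_quasiPendant_of_adj (hpe s) h) (hpe r)

/-! ### Eigenvectors of the extremal graph -/

/-- The eigenvector of the extremal graph with prescribed values on the inner paths. -/
def extremalVector {t : ℕ} (ht : 0 < t) (a : Fin t → ℝ) : Fin (3 * t) ⊕ Fin t → ℝ
  | Sum.inl i => if i.val % 3 = 0 then 0 else a ⟨i.val / 3, by omega⟩
  -- The second index is `s - 1` modulo `t`; the value balances the equation at the zero `3s`.
  | Sum.inr s => -(a s + a ⟨(s.val + t - 1) % t, Nat.mod_lt _ ht⟩)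

theorem extremalVector_spec {t : ℕ} (ht : 0 < t) (a : Fin t → ℝ) (w : Fin (3 * t) ⊕ Fin t) :
    ∃ N : Finset (Fin (3 * t) ⊕ Fin t), (∀ w', (extremalGraph t).Adj w w' ↔ w' ∈ N) ∧
      ∑ w' ∈ N, extremalVector ht a w' = ((N.card : ℝ) - 1) * extremalVector ht a w := by
  rcases w with i | s
  · have hi := i.isLt
    have hadj : ∀ j : Fin (3 * t), (extremalGraph t).Adj (Sum.inl i) (Sum.inl j) ↔
        j.val = (i.val + 1) % (3 * t) ∨ i.val = (j.val + 1) % (3 * t) := fun j =>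
      cycleGraph_adj_iff (by omega) i j
    have hadj' : ∀ s : Fin t, (extremalGraph t).Adj (Sum.inl i) (Sum.inr s) ↔
        i.val = 3 * s.val := fun s => Iff.rfl
    have hsucc : ∀ j, j < 3 * t →
        (j + 1) % (3 * t) = j + 1 ∧ j + 1 < 3 * t ∨ (j + 1) % (3 * t) = 0 ∧ j + 1 = 3 * t := by
      intro j hj
      rcases Nat.lt_or_ge (j + 1) (3 * t) with h | h
      · exact Or.inl ⟨Nat.mod_eq_of_lt h, h⟩
      · have : j + 1 = 3 * t := by omega
        exact Or.inr ⟨by rw [this, Nat.mod_self], this⟩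
    rcases (by omega : i.val % 3 = 0 ∨ i.val % 3 = 1 ∨ i.val % 3 = 2) with h | h | h
    · by_cases hi0 : i.val = 0
      · refine ⟨{Sum.inl ⟨1, by omega⟩, Sum.inl ⟨3 * t - 1, by omega⟩, Sum.inr ⟨0, ht⟩}, ?_, ?_⟩
        · rintro (j | s)
          · have := hsucc i i.isLt
            have := hsucc j j.isLt
            simp only [hadj, Finset.mem_insert, Finset.mem_singleton, Sum.inl.injEq, reduceCtorEq,
              or_false, Fin.ext_iff]
            omega
          · simp only [hadj', Finset.mem_insert, Finset.mem_singleton, Sum.inr.injEq, reduceCtorEq,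
              false_or, Fin.ext_iff]
            omega
        · rw [Finset.sum_insert (by simp; omega), Finset.sum_insert (by simp), Finset.sum_singleton]
          have e1 : (3 * t - 1) % 3 ≠ 0 := by omega
          have e2 : (3 * t - 1) / 3 = t - 1 := by omega
          have e3 : (0 + t - 1) % t = t - 1 := by
            rw [Nat.zero_add]; exact Nat.mod_eq_of_lt (by omega)
          simp [extremalVector, h, e1, e2, Nat.mod_eq_of_lt (show t - 1 < t by omega)]
      · refine ⟨{Sum.inl ⟨i.val + 1, by omega⟩, Sum.inl ⟨i.val - 1, by omega⟩,
          Sum.inr ⟨i.val / 3, by omega⟩}, ?_, ?_⟩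
        · rintro (j | s)
          · have := hsucc i i.isLt
            have := hsucc j j.isLt
            simp only [hadj, Finset.mem_insert, Finset.mem_singleton, Sum.inl.injEq, reduceCtorEq,
              or_false, Fin.ext_iff]
            omega
          · simp only [hadj', Finset.mem_insert, Finset.mem_singleton, Sum.inr.injEq, reduceCtorEq,
              false_or, Fin.ext_iff]
            omega
        · rw [Finset.sum_insert (by simp; omega), Finset.sum_insert (by simp), Finset.sum_singleton]
          have e1 : (i.val - 1) % 3 ≠ 0 := by omega
          have e2 : (i.val - 1) / 3 = i.val / 3 - 1 := by omega
          have e3 : (i.val / 3 + t - 1) % t = i.val / 3 - 1 := by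
            rw [show i.val / 3 + t - 1 = i.val / 3 - 1 + t by omega, Nat.add_mod_right]
            exact Nat.mod_eq_of_lt (by omega)
          have e4 : (i.val + 1) % 3 ≠ 0 := by omega
          have e5 : (i.val + 1) / 3 = i.val / 3 := by omega
          simp [extremalVector, h, e1, e2, e3, e4, e5]
    · refine ⟨{Sum.inl ⟨i.val + 1, by omega⟩, Sum.inl ⟨i.val - 1, by omega⟩}, ?_, ?_⟩
      · rintro (j | s)
        · have := hsucc i i.isLt
          have := hsucc j j.isLt
          simp only [hadj, Finset.mem_insert, Finset.mem_singleton, Sum.inl.injEq, Fin.ext_iff]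
          omega
        · simp only [hadj', Finset.mem_insert, Finset.mem_singleton, reduceCtorEq, or_self, iff_false]
          omega
      · have hne : (Sum.inl ⟨i.val + 1, by omega⟩ : Fin (3 * t) ⊕ Fin t) ≠
            Sum.inl ⟨i.val - 1, by omega⟩ := by simp; omega
        rw [Finset.sum_pair hne, Finset.card_pair hne]
        have e1 : (i.val - 1) % 3 = 0 := by omega
        have e4 : (i.val + 1) % 3 ≠ 0 := by omega
        have e5 : (i.val + 1) / 3 = i.val / 3 := by omega
        simp only [extremalVector, h, e1, e4, e5]
        norm_num
    · refine ⟨{Sum.inl ⟨i.val - 1, by omega⟩,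
        Sum.inl ⟨(i.val + 1) % (3 * t), Nat.mod_lt _ (by omega)⟩}, ?_, ?_⟩
      · rintro (j | s)
        · have := hsucc i i.isLt
          have := hsucc j j.isLt
          simp only [hadj, Finset.mem_insert, Finset.mem_singleton, Sum.inl.injEq, Fin.ext_iff]
          omega
        · simp only [hadj', Finset.mem_insert, Finset.mem_singleton, reduceCtorEq, or_self, iff_false]
          omega
      · have hs := hsucc i i.isLt
        have hne : (Sum.inl ⟨i.val - 1, by omega⟩ : Fin (3 * t) ⊕ Fin t) ≠
            Sum.inl ⟨(i.val + 1) % (3 * t), Nat.mod_lt _ (by omega)⟩ := by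
          simp only [Ne, Sum.inl.injEq, Fin.ext_iff]; omega
        rw [Finset.sum_pair hne, Finset.card_pair hne]
        have e1 : (i.val - 1) % 3 ≠ 0 := by omega
        have e4 : (i.val + 1) % (3 * t) % 3 = 0 := by omega
        have e5 : (i.val - 1) / 3 = i.val / 3 := by omega
        simp only [extremalVector, h, e1, e4, e5]
        norm_num
  · refine ⟨{Sum.inl ⟨3 * s.val, by omega⟩}, ?_, ?_⟩
    · rintro (j | r)
      · change j.val = 3 * s.val ↔ _
        simp [Fin.ext_iff]
      · change False ↔ _
        simp
    · simp [extremalVector]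

/-- The multiplicity of the extremal graph on `4 * t` vertices is at least `t`. -/
theorem le_finrank_of_iso {t : ℕ} (ht : 0 < t) (e : G ≃g extremalGraph t) :
    t ≤ Module.finrank ℝ (lapOneSpace G) := by
  classical
  have hmem : ∀ a : Fin t → ℝ, (fun v => extremalVector ht a (e v)) ∈ lapOneSpace G := by
    intro a
    rw [mem_lapOneSpace]
    intro v
    obtain ⟨N, hN, hsum⟩ := extremalVector_spec ht a (e v)
    have hnb : G.neighborFinset v = N.map e.symm.toEquiv.toEmbedding := by
      ext u
      rw [SimpleGraph.mem_neighborFinset, Finset.mem_map_equiv, ← e.map_adj_iff, hN]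
      rfl
    rw [← SimpleGraph.card_neighborFinset_eq_degree, hnb, Finset.card_map, Finset.sum_map, ← hsum]
    refine Finset.sum_congr rfl fun w _ => ?_
    change extremalVector ht a (e (e.symm w)) = _
    rw [e.apply_symm_apply]
  let f : (Fin t → ℝ) →ₗ[ℝ] lapOneSpace G :=
    { toFun := fun a => ⟨fun v => extremalVector ht a (e v), hmem a⟩
      map_add' := by
        intro a b
        ext v
        change extremalVector ht (a + b) (e v) =
          extremalVector ht a (e v) + extremalVector ht b (e v)
        rcases e v with i | s
        · simp only [extremalVector, Pi.add_apply]
          split_ifs <;> simp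
        · simp only [extremalVector, Pi.add_apply]
          ring
      map_smul' := by
        intro r a
        ext v
        change extremalVector ht (r • a) (e v) = r * extremalVector ht a (e v)
        rcases e v with i | s
        · simp only [extremalVector, Pi.smul_apply, smul_eq_mul]
          split_ifs <;> simp
        · simp only [extremalVector, Pi.smul_apply, smul_eq_mul]
          ring }
  have hf : Function.Injective f := by
    intro a b hab
    funext s
    have h := congrFun (congrArg Subtype.val hab) (e.symm (Sum.inl ⟨3 * s.val + 1, by omega⟩))
    change extremalVector ht a (e (e.symm _)) = extremalVector ht b (e (e.symm _)) at h
    rw [e.apply_symm_apply] at h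
    have e1 : (3 * s.val + 1) % 3 ≠ 0 := by omega
    have e2 : (3 * s.val + 1) / 3 = s.val := by omega
    simpa [extremalVector, e1, e2] using h
  have := LinearMap.finrank_le_finrank_of_injective hf
  simpa using this

theorem four_mul_finrank_of_iso (hn : 0 < Fintype.card V) {t : ℕ} (e : G ≃g extremalGraph t) :
    Fintype.card V ≤ 4 * Module.finrank ℝ (lapOneSpace G) := by
  have hcard := Fintype.card_congr e.toEquiv
  simp only [Fintype.card_sum, Fintype.card_fin] at hcard
  have := le_finrank_of_iso (by omega) e
  omega

/-! ### Assembling the bound and the equality case -/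

/-- The bound on the multiplicity of the Laplacian eigenvalue `1`, with the case of equality. -/
theorem four_mul_finrank_le (hn : 10 ≤ Fintype.card V) (huni : IsUnicyclic G)
    (hred : IsReducedGraph G) (hP3 : ¬ HasPendantPath G 3) :
    4 * Module.finrank ℝ (lapOneSpace G) ≤ Fintype.card V ∧
      (4 * Module.finrank ℝ (lapOneSpace G) = Fintype.card V →
        ∃ t : ℕ, Nonempty (G ≃g extremalGraph t)) := by
  obtain ⟨g, c, hc⟩ := huni.exists_isCycleEnum
  have hG := huni.1
  have hn3 : 3 ≤ Fintype.card V := by omega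
  rcases (pendantVertices G).eq_empty_or_nonempty with hp | hp
  -- Without pendant vertices the multiplicity is at most 2, and `4 * 2 < 10`.
  · have := hc.finrank_le_two hG hn3 hp
    exact ⟨by omega, fun h => by omega⟩
  by_cases hB : ∀ i, ∃ z ∈ lapOneSpace G, z (c i) ≠ 0
  · have := hc.four_mul_finrank_lt hG hn3 hred hp hB
    exact ⟨this.le, fun h => absurd h this.ne⟩
  push Not at hB
  obtain ⟨i, hi⟩ := hB
  replace hc := hc.shift i
  set c' : ℕ → V := fun j => c (j + i) with hc'
  have h0 : ∀ x ∈ lapOneSpace G, x (c' 0) = 0 := by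
    intro x hx
    simp only [hc', Nat.zero_add]
    exact hi x hx
  have h1 := hc.finrank_le_card_pendant hG hn3 hp h0
  obtain ⟨col, hcol⟩ := hc.exists_coloring
  have hcolZ : ∀ u v, G.Adj u v → u ∉ ({c' 0} : Finset V) → v ∉ ({c' 0} : Finset V) →
      col u ≠ col v := fun u v huv hu hv => hcol u v huv (by simpa using hu) (by simpa using hv)
  have hZ : ∀ x ∈ lapOneSpace G, ∀ z ∈ ({c' 0} : Finset V), x z = 0 := by
    intro x hx z hz
    rw [Finset.mem_singleton.1 hz]
    exact h0 x hx
  have h2 := two_mul_finrank_le hG hn3 hred hcolZ le_rfl hZ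
  have hcard := card_inner hG hn3
  have hpq : (pendantVertices G).card = (quasiPendantVertices G).card := hred
  have hle := Finset.card_le_card (Finset.sdiff_subset (s := innerVertices G) (t := {c' 0}))
  refine ⟨by omega, fun heq => ?_⟩
  -- Were the common zero inner, it could be dropped from the count of inner vertices, making the
  -- bound strict.
  have hq0 : c' 0 ∈ quasiPendantVertices G := by
    by_contra hq
    have hin : c' 0 ∈ innerVertices G :=
      mem_innerVertices.2 ⟨hc.not_pendant (hc.apply_mem 0), hq⟩
    rw [Finset.card_sdiff_of_subset (by simpa using hin), Finset.card_singleton] at h2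
    have := Finset.card_pos.2 ⟨_, hin⟩
    omega
  have hinZ : innerVertices G \ {c' 0} = innerVertices G := by
    rw [Finset.sdiff_eq_self_iff_disjoint, Finset.disjoint_singleton_right]
    exact not_mem_inner_of_mem_quasiPendant hq0
  have hRcol : ∀ u ∈ innerVertices G, ∀ v ∈ innerVertices G, G.Adj u v → col u ≠ col v := by
    have hne : ∀ u ∈ innerVertices G, u ≠ c' 0 := fun u hu h =>
      not_mem_inner_of_mem_quasiPendant hq0 (h ▸ hu)
    exact fun u hu v hv huv => hcol u v huv (hne u hu) (hne v hv)
  -- Each class has at least `m` elements and together they have `2m`, so both bounds are tight.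
  have hclass : ∀ b : Fin 2, ((innerVertices G \ {c' 0}).filter (fun v => col v = b)).card ≤
      Module.finrank ℝ (lapOneSpace G) := by
    have e0 := finrank_le_colorClass hG hn3 hred hcolZ 0 le_rfl hZ
    have e1 := finrank_le_colorClass hG hn3 hred hcolZ 1 le_rfl hZ
    have e2 := card_colorClass (innerVertices G \ {c' 0}) col
    rw [Fin.forall_fin_two]
    omega
  have hext : ∀ a ∈ innerVertices G, ∃ x ∈ lapOneSpace G, x a = 1 ∧
      ∀ a' ∈ innerVertices G, col a' = col a → a' ≠ a → x a' = 0 := by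
    intro a ha
    obtain ⟨x, hx, hxs⟩ := exists_extend_of_card_le (lapOneSpace G) _
      (fun x hx h => eq_zero_of_colorClass hG hn3 hred hcolZ (col a) hx (hZ x hx) h)
      (hclass (col a)) (Pi.single a 1)
    rw [hinZ] at hxs
    refine ⟨x, hx, ?_, fun a' ha' hcc hne => ?_⟩
    · rw [hxs a (by simp [ha])]; simp
    · rw [hxs a' (by simp [ha', hcc])]; simp [hne]
  have hR := inner_structure_of_extend hG hn3 hRcol hext
  have hQ := hc.quasiPendant_structure hG hn3 hred hP3 hR (by omega)
  exact ⟨_, hc.nonempty_iso hG hn3 hR hQ (by omega) hq0⟩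

end

end ReducedUnicyclic

theorem theorem3 {V : Type*} [Fintype V] [DecidableEq V] (G : SimpleGraph V) [DecidableRel G.Adj]
    (hn : 10 ≤ Fintype.card V)
    (huni : ReducedUnicyclic.IsUnicyclic G)
    (hred : ReducedUnicyclic.IsReducedGraph G)
    (hP3 : ¬ ReducedUnicyclic.HasPendantPath G 3) :
    (ReducedUnicyclic.lapMultiplicity G 1 : ℝ) ≤ (Fintype.card V : ℝ) / 4 ∧
      ((ReducedUnicyclic.lapMultiplicity G 1 : ℝ) = (Fintype.card V : ℝ) / 4 ↔
        ∃ t : ℕ, Nonempty (G ≃g ReducedUnicyclic.extremalGraph t)) := by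
  have hm : ReducedUnicyclic.lapMultiplicity G 1 =
      Module.finrank ℝ (ReducedUnicyclic.lapOneSpace G) := rfl
  obtain ⟨hle, heq⟩ := ReducedUnicyclic.four_mul_finrank_le hn huni hred hP3
  rw [← hm] at hle heq
  have hle' : 4 * (ReducedUnicyclic.lapMultiplicity G 1 : ℝ) ≤ Fintype.card V := by
    exact_mod_cast hle
  refine ⟨by linarith, fun h => heq ?_, ?_⟩
  · have : 4 * (ReducedUnicyclic.lapMultiplicity G 1 : ℝ) = Fintype.card V := by linarith
    exact_mod_cast this
  · rintro ⟨t, ⟨e⟩⟩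
    have hge := ReducedUnicyclic.four_mul_finrank_of_iso (by omega) e
    rw [← hm] at hge
    have hge' : (Fintype.card V : ℝ) ≤ 4 * (ReducedUnicyclic.lapMultiplicity G 1 : ℝ) := by
      exact_mod_cast hge
    linarith
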